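/- Let $m,n,N\ge 1$. An infinite grid $G$ consists of vertical lines $x=x_i$ and horizontal lines $y=y_j$ ($i,j\in\mathbb Z$), where $(x_i)$ and $(y_j)$ are strictly increasing and tend to $\pm\infty$ as the index tends to $\pm\infty$; its cells are the closed rectangles $[x_i,x_{i+1}]\times[y_j,y_{j+1}]$. The following classes depend only on which cells form a domain. * A finite union of cells of a one-dimensional grid is in $\mathcal A^1_1$ if the number of cells between any two neighbouring segments of it exceeds $1$. * A finite union $\Omega$ of cells of $G$ is in $\mathcal A^2_{0,0}$ if it is a topological $2$-manifold with boundary, that is, no $2\times2$ block of cells meets it in exactly two diagonally opposite cells. It is in $\mathcal A^2_{1,0}$ (resp. $\mathcal A^2_{0,1}$) if moreover each of its intersections with a horizontal (resp. vertical) line is in $\mathcal A^1_1$; on a grid line this intersection is the union of the two adjacent rows (resp. columns). * The dilatation $\Omega^e_{1,0}$ (resp. $\Omega^e_{0,1}$) is the union of the cells of the grid shifted horizontally (resp. vertically) by half a cell which are bisected by the vertical (resp. horizontal) edges of the cells of $\Omega$; $\Omega^e_{k_1,k_2}$ is the result of $k_1$ horizontal and $k_2$ vertical dilatations. * Recursively,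 $\Omega\in\mathcal A^2_{k_1+1,k_2}$ iff $\Omega\in\mathcal A^2_{k_1,k_2}$ and $\Omega^e_{k_1,k_2}\in\mathcal A^2_{1,0}$, and $\Omega\in\mathcal A^2_{0,k_2+1}$ iff $\Omega\in\mathcal A^2_{0,k_2}$ and $\Omega^e_{0,k_2}\in\mathcal A^2_{0,1}$. * $\Omega\in\widetilde{\mathcal A}^2_{k_1,k_2}$ iff $\Omega\in\mathcal A^2_{0,0}$ and $\widehat\Omega\setminus\mathrm{int}\,\Omega\in\mathcal A^2_{k_1,k_2}$ for a rectangle $\widehat\Omega$ formed by cells with $\Omega\subset\mathrm{int}\,\widehat\Omega$. A hierarchical mesh $\mathcal H$ is given by nested grids $G^0\subset\dots\subset G^{N-1}$ and nested domains $\Omega^0\supset\dots\supset\Omega^{N-1}\supset\Omega^N=\varnothing$, where $\Omega^\ell$ is a finite union of cells of $G^\ell$ for $\ell=0,\dots,N-1$ and $\partial\Omega^\ell$ lies on lines of $G^{\ell-1}$ for $\ell=1,\dots,N-1$. Let $T^\ell$ be the set of tensor-product B-splines of bi-degree $(m,n)$ with simple knots over $G^\ell$ and put $R^{-1}=\varnothing$,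 $R^\ell=\Omega^0\setminus\Omega^{\ell+1}$. The hierarchical B-splines are $\mathcal K(\mathcal H)=\bigcup_{\ell=0}^{N-1}\mathcal K^\ell(\mathcal H)$ with $$\mathcal K^\ell(\mathcal H)=\{\tau\in T^\ell:\ \mathrm{supp}\,\tau\cap\mathrm{int}\,R^{\ell-1}=\varnothing,\ \mathrm{supp}\,\tau\cap\mathrm{int}\,R^{\ell}\neq\varnothing\}.$$ For a level $0\le j\le N-1$ and a vertical or horizontal line $l$ that is not a line of $G^{N-1}$, let $\mathcal H^{j}_{l}$ be the mesh with the same domains and with the grids $G^\ell$ for $\ell<j$ and $G^\ell\cup\{l\}$ for $\ell\ge j$. Let $\mathcal H^{j_1,\dots,j_k}_{l_1,\dots,l_k}$ be the result of $k$ consecutive refinements of this kind. **Proposition.** Suppose that $\Omega^0\in\mathcal A^2_{m-1,n-1}$ with respect to $G^0$; that $\Omega^\ell\in\widetilde{\mathcal A}^2_{m-1,n-1}$ with respect to $G^{\ell-1}$ and $\Omega^\ell\in\widetilde{\mathcal A}^2_{m,n}$ with respect to $G^\ell$ for $\ell=1,\dots,N-1$; and that $\partial\Omega^0\cap\partial\Omega^1=\varnothing$.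 If there are weights $w^0_\tau>0$, $\tau\in\mathcal K(\mathcal H)$, with $\sum_{\tau\in\mathcal K(\mathcal H)}w^0_\tau\,\tau=1$ on $\Omega^0$, then for every refinement $\mathcal H'=\mathcal H^{j_1,\dots,j_k}_{l_1,\dots,l_k}$ there are weights $w^1_\tau>0$, $\tau\in\mathcal K(\mathcal H')$, with $\sum_{\tau\in\mathcal K(\mathcal H')}w^1_\tau\,\tau=1$ on $\Omega^0$. -/

import Mathlib

open Set Filter

/-! ### Infinite grids -/

/-- A bi-infinite, strictly increasing and locally finite sequence of nodes on the real line
(an infinite one-dimensional grid). -/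
structure KnotSeq where
  knot : ℤ → ℝ
  strictMono : StrictMono knot
  tendsto_atTop : Tendsto knot atTop atTop
  tendsto_atBot : Tendsto knot atBot atBot

/-- Closed form of the increasing enumeration of the nodes of `x` together with a new node `t`. -/
noncomputable def insertFun (x : ℤ → ℝ) (t : ℝ) (i : ℤ) : ℝ :=
  if x i < t then x i else max t (x (i - 1))

theorem insertFun_strictMono {x : ℤ → ℝ} (hx : StrictMono x) {t : ℝ} (ht : t ∉ Set.range x) :
    StrictMono (insertFun x t) := by
  intro i j hij
  have h1 : x i < x j := hx hij
  have h2 : x (i - 1) < x i := hx (by omega)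
  have h3 : x i ≤ x (j - 1) := hx.monotone (by omega)
  have h4 : x i ≠ t := fun h => ht ⟨i, h⟩
  unfold insertFun
  split_ifs with ha hb hb
  · exact h1
  · exact lt_of_lt_of_le ha (le_max_left _ _)
  · exact absurd (h1.trans hb) ha
  · have h5 : t < x i := lt_of_le_of_ne (not_lt.mp ha) (Ne.symm h4)
    exact max_lt (lt_of_lt_of_le h5 (h3.trans (le_max_right _ _)))
      (lt_of_lt_of_le (h2.trans_le h3) (le_max_right _ _))

theorem insertFun_range {x : ℤ → ℝ} (hx : StrictMono x) (hT : Tendsto x atTop atTop)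
    (hB : Tendsto x atBot atBot) (t : ℝ) :
    Set.range (insertFun x t) = insert t (Set.range x) := by
  have hk : ∃ k, x k < t ∧ t ≤ x (k + 1) := by
    obtain ⟨b, hb⟩ := (hT.eventually_ge_atTop t).exists
    obtain ⟨a, ha⟩ := (hB.eventually_lt_atBot t).exists
    obtain ⟨k, hk1, hk2⟩ := Int.exists_greatest_of_bdd (P := fun k => x k < t)
      ⟨b, fun z hz => by
        by_contra hlt
        exact absurd (hb.trans (hx.monotone (not_le.mp hlt).le)) (not_le.mpr hz)⟩ ⟨a, ha⟩
    refine ⟨k, hk1, ?_⟩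
    by_contra hlt
    have := hk2 (k + 1) (not_le.mp hlt)
    omega
  obtain ⟨k, hk1, hk2⟩ := hk
  ext r
  constructor
  · rintro ⟨i, rfl⟩
    unfold insertFun
    split_ifs with h
    · exact Or.inr ⟨i, rfl⟩
    · rcases max_choice t (x (i - 1)) with h' | h' <;> rw [h']
      · exact Or.inl rfl
      · exact Or.inr ⟨_, rfl⟩
  · rintro (rfl | ⟨i, rfl⟩)
    · refine ⟨k + 1, ?_⟩
      simp [insertFun, not_lt.mpr hk2, hk1.le]
    · by_cases h : x i < t
      · exact ⟨i, by simp [insertFun, h]⟩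
      · refine ⟨i + 1, ?_⟩
        have : t ≤ x (i + 1) := (not_lt.mp h).trans (hx.monotone (by omega))
        simp [insertFun, not_lt.mpr this, not_lt.mp h]

namespace KnotSeq

open Classical in
/-- The grid `X ∪ {t}` (equal to `X` if `t` is already a node). -/
noncomputable def insertKnot (X : KnotSeq) (t : ℝ) : KnotSeq :=
  if ht : t ∈ Set.range X.knot then X else
  { knot := insertFun X.knot t
    strictMono := insertFun_strictMono X.strictMono ht
    tendsto_atTop := by
      refine tendsto_atTop_mono (fun i => ?_)
        (X.tendsto_atTop.comp (tendsto_atTop_add_const_right atTop (-1 : ℤ) tendsto_id))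
      simp only [Function.comp, id, insertFun]
      split_ifs
      · exact X.strictMono.monotone (by omega)
      · exact le_max_right _ _
    tendsto_atBot := by
      refine X.tendsto_atBot.congr' ?_
      filter_upwards [X.tendsto_atBot.eventually_lt_atBot t] with i hi
      simp [insertFun, hi] }

theorem range_insertKnot (X : KnotSeq) (t : ℝ) :
    Set.range (X.insertKnot t).knot = insert t (Set.range X.knot) := by
  unfold insertKnot
  split_ifs with ht
  · exact (Set.insert_eq_of_mem ht).symm
  · exact insertFun_range X.strictMono X.tendsto_atTop X.tendsto_atBot t

/-- The normalized B-spline of degree `p` with the simple knots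
`X.knot i, …, X.knot (i + p + 1)` (Cox–de Boor recursion). -/
noncomputable def bspline (X : KnotSeq) : ℕ → ℤ → ℝ → ℝ
  | 0, i, x => (Set.Ico (X.knot i) (X.knot (i + 1))).indicator (fun _ => 1) x
  | p + 1, i, x =>
      (x - X.knot i) / (X.knot (i + p + 1) - X.knot i) * bspline X p i x +
      (X.knot (i + p + 2) - x) / (X.knot (i + p + 2) - X.knot (i + 1)) * bspline X p (i + 1) x

end KnotSeq

/-- A vertical line `x = t` or a horizontal line `y = t`. -/
inductive AxisLine where
  | vertical (t : ℝ)
  | horizontal (t : ℝ)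

/-- An infinite two-dimensional grid: `xs` are the abscissae of its vertical lines, `ys` the
ordinates of its horizontal lines. -/
structure Grid where
  xs : KnotSeq
  ys : KnotSeq

namespace Grid

/-- The closed cell in the `p.1`-th column and the `p.2`-th row. -/
def cell (G : Grid) (p : ℤ × ℤ) : Set (ℝ × ℝ) :=
  Set.Icc (G.xs.knot p.1) (G.xs.knot (p.1 + 1)) ×ˢ Set.Icc (G.ys.knot p.2) (G.ys.knot (p.2 + 1))

/-- The union of the cells with indices in `S`. -/
def region (G : Grid) (S : Set (ℤ × ℤ)) : Set (ℝ × ℝ) := ⋃ p ∈ S, G.cell p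

/-- The union of all grid lines. -/
def lines (G : Grid) : Set (ℝ × ℝ) :=
  {q | q.1 ∈ Set.range G.xs.knot ∨ q.2 ∈ Set.range G.ys.knot}

/-- Every line of `G` is a line of `G'`. -/
def Sub (G G' : Grid) : Prop :=
  Set.range G.xs.knot ⊆ Set.range G'.xs.knot ∧ Set.range G.ys.knot ⊆ Set.range G'.ys.knot

/-- `l` is one of the lines of `G`. -/
def HasLine (G : Grid) : AxisLine → Prop
  | .vertical t => t ∈ Set.range G.xs.knot
  | .horizontal t => t ∈ Set.range G.ys.knot

/-- The grid `G ∪ {l}`. -/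
noncomputable def insertLine (G : Grid) : AxisLine → Grid
  | .vertical t => ⟨G.xs.insertKnot t, G.ys⟩
  | .horizontal t => ⟨G.xs, G.ys.insertKnot t⟩

/-- The set `T` of all tensor-product B-splines of bi-degree `(m, n)` over `G`, with simple
knots. -/
def tensorBSplines (G : Grid) (m n : ℕ) : Set (ℝ × ℝ → ℝ) :=
  {τ | ∃ i j : ℤ, τ = fun q => G.xs.bspline m i q.1 * G.ys.bspline n j q.2}

end Grid

/-! ### Admissible classes of domains

The classes depend only on which cells of the grid form the domain, so they are defined on sets
`S ⊆ ℤ × ℤ` of indices `(column, row)` of cells. -/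

/-- The class `𝒜_k^1`: a finite set of cells of a one-dimensional grid such that the number of
cells between any two neighbouring segments exceeds `k`. -/
def OffsetClass1 (k : ℕ) (D : Set ℤ) : Prop :=
  D.Finite ∧ ∀ a ∈ D, ∀ b ∈ D, a + 1 < b → (∀ c, a < c → c < b → c ∉ D) → (k : ℤ) < b - a - 1

/-- The cells of the `j`-th row, projected to the horizontal axis. -/
def rowOf (S : Set (ℤ × ℤ)) (j : ℤ) : Set ℤ := {i | (i, j) ∈ S}

/-- The cells of the `i`-th column, projected to the vertical axis. -/
def colOf (S : Set (ℤ × ℤ)) (i : ℤ) : Set ℤ := {j | (i, j) ∈ S}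

/-- The horizontal dilatation `Ω_{1,0}^e`: the cells of the horizontally half-shifted grid that
are bisected by the vertical edges of the cells of `S`. The shifted cell with index `i` is the
one centred at the left edge of column `i`; a cell in column `i` has its vertical edges at the
indices `i` and `i + 1`. -/
def dilH (S : Set (ℤ × ℤ)) : Set (ℤ × ℤ) := {p | p ∈ S ∨ (p.1 - 1, p.2) ∈ S}

/-- The vertical dilatation `Ω_{0,1}^e`. -/
def dilV (S : Set (ℤ × ℤ)) : Set (ℤ × ℤ) := {p | p ∈ S ∨ (p.1, p.2 - 1) ∈ S}

/-- The dilatation `Ω_{k₁,k₂}^e`. -/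
def dil (k₁ k₂ : ℕ) (S : Set (ℤ × ℤ)) : Set (ℤ × ℤ) := dilH^[k₁] (dilV^[k₂] S)

/-- The class `𝒜_{0,0}^2` of bounded domains that are topological manifolds with boundary: a
finite union of cells is one iff no `2 × 2` block of cells meets it in exactly two diagonally
opposite cells. -/
def ManifoldClass (S : Set (ℤ × ℤ)) : Prop :=
  S.Finite ∧ ∀ i j : ℤ,
    ¬ ((i, j) ∈ S ∧ (i + 1, j + 1) ∈ S ∧ (i + 1, j) ∉ S ∧ (i, j + 1) ∉ S) ∧
    ¬ ((i, j) ∉ S ∧ (i + 1, j + 1) ∉ S ∧ (i + 1, j) ∈ S ∧ (i, j + 1) ∈ S)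

/-- The class `𝒜_{1,0}^2`: each row and each union of two consecutive rows is in `𝒜_1^1`, i.e.
every intersection of the domain with a horizontal line is in `𝒜_1^1` (a grid line between two
rows meets the domain in the union of the two rows). -/
def HOffset (S : Set (ℤ × ℤ)) : Prop :=
  ManifoldClass S ∧ ∀ j : ℤ,
    OffsetClass1 1 (rowOf S j) ∧ OffsetClass1 1 (rowOf S j ∪ rowOf S (j + 1))

/-- The class `𝒜_{0,1}^2`: each column and each union of two consecutive columns is in
`𝒜_1^1`. -/
def VOffset (S : Set (ℤ × ℤ)) : Prop :=
  ManifoldClass S ∧ ∀ i : ℤ,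
    OffsetClass1 1 (colOf S i) ∧ OffsetClass1 1 (colOf S i ∪ colOf S (i + 1))

/-- The class `𝒜_{k₁,k₂}^2` in terms of the indices of the cells. -/
def OffsetClass2 : ℕ → ℕ → Set (ℤ × ℤ) → Prop
  | 0, 0, S => ManifoldClass S
  | 0, k₂ + 1, S => OffsetClass2 0 k₂ S ∧ VOffset (dil 0 k₂ S)
  | k₁ + 1, k₂, S => OffsetClass2 k₁ k₂ S ∧ HOffset (dil k₁ k₂ S)

namespace Grid

/-- `Ω ∈ 𝒜_{k₁,k₂}^2` with respect to the grid `G`. -/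
def ClassA (G : Grid) (k₁ k₂ : ℕ) (Ω : Set (ℝ × ℝ)) : Prop :=
  ∃ S : Set (ℤ × ℤ), Ω = G.region S ∧ OffsetClass2 k₁ k₂ S

/-- `Ω ∈ 𝒜̃_{k₁,k₂}^2` with respect to the grid `G`: for a rectangle formed by cells of `G` that
contains `Ω` in its interior, the complement of `int Ω` in that rectangle is in
`𝒜_{k₁,k₂}^2`. -/
def ClassATilde (G : Grid) (k₁ k₂ : ℕ) (Ω : Set (ℝ × ℝ)) : Prop :=
  G.ClassA 0 0 Ω ∧ ∃ a b c d : ℤ,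
    Ω ⊆ interior (G.region (Set.Icc a b ×ˢ Set.Icc c d)) ∧
    G.ClassA k₁ k₂ (G.region (Set.Icc a b ×ˢ Set.Icc c d) \ interior Ω)

end Grid

/-! ### Hierarchical meshes -/

/-- The data of a hierarchical T-mesh with `N` levels: the grids `G^ℓ` for `ℓ < N` and the domains
`Ω^ℓ` for `ℓ ≤ N`. The values at larger indices are never used. -/
structure HierData (N : ℕ) where
  grid : ℕ → Grid
  dom : ℕ → Set (ℝ × ℝ)

namespace HierData

variable {N : ℕ}

/-- The standing assumptions on a hierarchical T-mesh. -/
structure IsTMesh (H : HierData N) : Prop where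
  grid_nested : ∀ ℓ, ℓ + 1 < N → (H.grid ℓ).Sub (H.grid (ℓ + 1))
  dom_nested : ∀ ℓ, ℓ < N → H.dom (ℓ + 1) ⊆ H.dom ℓ
  dom_last : H.dom N = ∅
  dom_cells : ∀ ℓ, ℓ < N → ∃ S : Set (ℤ × ℤ), S.Finite ∧ H.dom ℓ = (H.grid ℓ).region S
  dom_aligned : ∀ ℓ, ℓ + 1 < N → frontier (H.dom (ℓ + 1)) ⊆ (H.grid ℓ).lines

/-- `𝒦^ℓ`: the B-splines of `T^ℓ` whose support does not meet the interior of
`R^{ℓ-1} = Ω^0 \ Ω^ℓ` (empty for `ℓ = 0`) but meets the interior of `R^ℓ = Ω^0 \ Ω^{ℓ+1}`. -/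
def levelBSplines (H : HierData N) (m n ℓ : ℕ) : Set (ℝ × ℝ → ℝ) :=
  {τ | τ ∈ (H.grid ℓ).tensorBSplines m n ∧
    tsupport τ ∩ interior (H.dom 0 \ H.dom ℓ) = ∅ ∧
    (tsupport τ ∩ interior (H.dom 0 \ H.dom (ℓ + 1))).Nonempty}

/-- The set `𝒦(ℋ)` of hierarchical B-splines of bi-degree `(m, n)`. -/
def hierBSplines (H : HierData N) (m n : ℕ) : Set (ℝ × ℝ → ℝ) :=
  {τ | ∃ ℓ < N, τ ∈ H.levelBSplines m n ℓ}

/-- Some positive weights turn the hierarchical B-splines into a partition of unity on `Ω^0`.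
(At each point only finitely many of the summands are nonzero.) -/
def HasWeightedPartition (H : HierData N) (m n : ℕ) : Prop :=
  ∃ w : (ℝ × ℝ → ℝ) → ℝ, (∀ τ ∈ H.hierBSplines m n, 0 < w τ) ∧
    ∀ q ∈ H.dom 0, ∑ᶠ τ ∈ H.hierBSplines m n, w τ * τ q = 1

/-- The refinement by the line `l` at level `j`: the line is added to the grids `G^ℓ` with
`ℓ ≥ j`, and the domains are kept. -/
noncomputable def refine (H : HierData N) (j : ℕ) (l : AxisLine) : HierData N where
  grid ℓ := if j ≤ ℓ then (H.grid ℓ).insertLine l else H.grid ℓ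
  dom := H.dom

/-- The consecutive refinements by the lines `l₁, …, l_k` at levels `j₁, …, j_k`, for the list
`[(j₁, l₁), …, (j_k, l_k)]`. -/
noncomputable def refineList (H : HierData N) : List (ℕ × AxisLine) → HierData N
  | [] => H
  | (j, l) :: L => (H.refine j l).refineList L

/-- Every level of the list is at most `N - 1`, and every line is new for the finest grid
of the mesh to which it is added. -/
def NewLines (H : HierData N) : List (ℕ × AxisLine) → Prop
  | [] => True
  | (j, l) :: L => j < N ∧ ¬ (H.grid (N - 1)).HasLine l ∧ (H.refine j l).NewLines L

end HierData

/-! It suffices to treat one inserted line, since the assumptions used are kept by the insertion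
(`HierData.IsExtendable.refine`). Inserting a knot writes each B-spline as a non-negative
combination of B-splines with smaller supports. Descending through the levels, every old
hierarchical B-spline is therefore a non-negative combination of new ones on Ω^0
(`HierData.mem_nonnegCombinations_of_tsupport`), and so is the constant 1. The difficulty is strict
positivity.

For a new hierarchical B-spline τ it is enough to find an old one σ of the same level, a parent,
with σ = α τ + g, where α > 0 and g is a non-negative combination. Substituting this into the old
partition of unity gives a representation of 1 in which τ has a positive weight; the average of
these representations over all τ has only positive weights (`exists_positive_weights`).

The parent must also be a hierarchical B-spline, and for level ℓ ≥ 1 this means that its support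
stays in Ω^ℓ (`Grid.exists_parent`). Either some parent touches only cells which the support of τ
touches already, or there are two candidates, which extend the support of τ by one cell in opposite
directions. The offset condition on Ω^ℓ says exactly what is needed in the second case: a small
block of cells in Ω^ℓ can be extended within Ω^ℓ to one of the two sides (`OffsetClass2.extendsH`,
`OffsetClass2.extendsV`). This condition always refers to the original grid of the level, so later
lines do not affect it. -/

open scoped NNReal

/-! ### Univariate B-splines: support and positivity. -/

namespace KnotSeq

variable (X Y : KnotSeq)

theorem knot_lt_iff {i j : ℤ} : X.knot i < X.knot j ↔ i < j := X.strictMono.lt_iff_lt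

theorem knot_le_iff {i j : ℤ} : X.knot i ≤ X.knot j ↔ i ≤ j := X.strictMono.le_iff_le

theorem bspline_eq_zero (p : ℕ) (i : ℤ) (x : ℝ)
    (hx : x ∉ Ico (X.knot i) (X.knot (i + p + 1))) : X.bspline p i x = 0 := by
  induction p generalizing i with
  | zero => simpa [bspline] using hx
  | succ p ih =>
    have h1 : X.knot (i + p + 1) < X.knot (i + p + 2) := X.strictMono (by omega)
    have h2 : X.knot i < X.knot (i + 1) := X.strictMono (by omega)
    have e1 : i + ((p + 1 : ℕ) : ℤ) + 1 = i + p + 2 := by push_cast; ring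
    have e2 : i + 1 + (p : ℤ) + 1 = i + p + 2 := by ring
    rw [e1] at hx
    rw [bspline, ih i, ih (i + 1)]
    · simp
    · rw [e2]; exact fun h => hx ⟨h2.le.trans h.1, h.2⟩
    · exact fun h => hx ⟨h.1, h.2.trans h1⟩

/-- In positive degree the linear factor kills the value at the left end knot, the only end that the
half-open convention of degree 0 includes. -/
theorem bspline_succ_eq_zero (p : ℕ) (i : ℤ) (x : ℝ)
    (hx : x ∉ Ioo (X.knot i) (X.knot (i + p + 2))) : X.bspline (p + 1) i x = 0 := by
  by_cases h : x = X.knot i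
  · subst h
    rw [bspline, X.bspline_eq_zero p (i + 1)]
    · simp
    · exact fun h => absurd h.1 (not_le.2 (X.strictMono (by omega)))
  · apply bspline_eq_zero
    have e1 : i + ((p + 1 : ℕ) : ℤ) + 1 = i + p + 2 := by push_cast; ring
    rw [e1]
    exact fun h' => hx ⟨lt_of_le_of_ne h'.1 (Ne.symm h), h'.2⟩

theorem bspline_nonneg (p : ℕ) (i : ℤ) (x : ℝ) : 0 ≤ X.bspline p i x := by
  induction p generalizing i with
  | zero => exact indicator_nonneg (fun _ _ => zero_le_one) _
  | succ p ih =>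
    by_cases hx : x ∈ Ioo (X.knot i) (X.knot (i + p + 2))
    · have h1 : X.knot i < X.knot (i + p + 1) := X.strictMono (by omega)
      have h2 : X.knot (i + 1) < X.knot (i + p + 2) := X.strictMono (by omega)
      rw [bspline]
      exact add_nonneg
        (mul_nonneg (div_nonneg (sub_nonneg.2 hx.1.le) (sub_nonneg.2 h1.le)) (ih i))
        (mul_nonneg (div_nonneg (sub_nonneg.2 hx.2.le) (sub_nonneg.2 h2.le)) (ih (i + 1)))
    · rw [bspline_succ_eq_zero _ _ _ _ hx]

theorem bspline_pos (p : ℕ) (i : ℤ) (x : ℝ) (hx : x ∈ Ioo (X.knot i) (X.knot (i + p + 1))) :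
    0 < X.bspline p i x := by
  induction p generalizing i with
  | zero =>
    have hx' : x ∈ Ico (X.knot i) (X.knot (i + 1)) := ⟨hx.1.le, by simpa using hx.2⟩
    simp [bspline, hx']
  | succ p ih =>
    have e1 : i + ((p + 1 : ℕ) : ℤ) + 1 = i + p + 2 := by push_cast; ring
    have e2 : i + 1 + (p : ℤ) + 1 = i + p + 2 := by ring
    rw [e1] at hx
    have h1 : X.knot i < X.knot (i + p + 1) := X.strictMono (by omega)
    have h2 : X.knot (i + 1) < X.knot (i + p + 2) := X.strictMono (by omega)
    rw [bspline]
    by_cases h : x < X.knot (i + p + 1)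
    · exact add_pos_of_pos_of_nonneg
        (mul_pos (div_pos (sub_pos.2 hx.1) (sub_pos.2 h1)) (ih i ⟨hx.1, h⟩))
        (mul_nonneg (div_nonneg (sub_nonneg.2 hx.2.le) (sub_nonneg.2 h2.le))
          (X.bspline_nonneg p _ x))
    · refine add_pos_of_nonneg_of_pos
        (mul_nonneg (div_nonneg (sub_nonneg.2 hx.1.le) (sub_nonneg.2 h1.le))
          (X.bspline_nonneg p _ x))
        (mul_pos (div_pos (sub_pos.2 hx.2) (sub_pos.2 h2)) ?_)
      -- The first summand may vanish here, so the second must be positive. In degree 0 the point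
      -- may be the left end knot, which the half-open interval contains; in higher degree it lies
      -- strictly beyond that knot.
      rcases p with _ | p
      · have hx' : x ∈ Ico (X.knot (i + 1)) (X.knot (i + 1 + 1)) :=
          ⟨by simpa using h, by convert hx.2 using 2; simp; ring⟩
        simp [bspline, hx']
      · refine ih (i + 1) ⟨lt_of_lt_of_le (X.strictMono (by push_cast; omega)) (not_lt.1 h), ?_⟩
        rw [e2]; exact hx.2

theorem support_bspline {p : ℕ} (hp : 1 ≤ p) (i : ℤ) :
    Function.support (X.bspline p i) = Ioo (X.knot i) (X.knot (i + p + 1)) := by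
  obtain ⟨p, rfl⟩ := Nat.exists_eq_add_of_le' hp
  ext x
  refine ⟨fun h => ?_, fun h => (X.bspline_pos _ i x h).ne'⟩
  by_contra hx
  refine h (X.bspline_succ_eq_zero p i x ?_)
  convert hx using 3
  push_cast; ring_nf

theorem bspline_congr (p : ℕ) (i j : ℤ) (h : ∀ r : ℕ, r ≤ p + 1 → X.knot (i + r) = Y.knot (j + r)) :
    X.bspline p i = Y.bspline p j := by
  induction p generalizing i j with
  | zero =>
    have h0 := h 0 (by omega)
    have h1 := h 1 (by omega)
    ext x
    simp only [Nat.cast_zero, add_zero, Nat.cast_one] at h0 h1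
    simp [bspline, h0, h1]
  | succ p ih =>
    have h0 := h 0 (by omega)
    have h1 := h 1 (by omega)
    have h2 := h (p + 1) (by omega)
    have h3 := h (p + 2) (by omega)
    push_cast at h0 h1 h2 h3
    simp only [add_zero, ← add_assoc] at h0 h1 h2 h3
    have ih1 := ih i j (fun r hr => h r (by omega))
    have ih2 := ih (i + 1) (j + 1) (fun r hr => by
      have := h (r + 1) (by omega)
      push_cast at this
      rw [show i + 1 + (r : ℤ) = i + (r + 1) by ring, this]; congr 1; ring)
    ext x
    simp only [bspline, h0, h1, h2, h3, ih1, ih2]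

/-! ### Knot insertion -/

variable {X} {t : ℝ}

theorem insertKnot_knot_eq_ite (ht : t ∉ range X.knot) (i : ℤ) :
    (X.insertKnot t).knot i = if X.knot i < t then X.knot i else max t (X.knot (i - 1)) := by
  simp [insertKnot, ht, insertFun]

theorem insertKnot_knot_of_lt (ht : t ∉ range X.knot) {i : ℤ} (h : X.knot i < t) :
    (X.insertKnot t).knot i = X.knot i := by
  simp [insertKnot, ht, insertFun, h]

theorem insertKnot_knot_of_gt (ht : t ∉ range X.knot) {i : ℤ} (h : t < X.knot (i - 1)) :
    (X.insertKnot t).knot i = X.knot (i - 1) := by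
  have h1 : X.knot (i - 1) < X.knot i := X.strictMono (by omega)
  simp [insertKnot, ht, insertFun, not_lt.2 (h.trans h1).le, h.le]

theorem insertKnot_knot_of_mem (ht : t ∉ range X.knot) {i : ℤ} (h1 : X.knot (i - 1) < t)
    (h2 : t < X.knot i) : (X.insertKnot t).knot i = t := by
  simp [insertKnot, ht, insertFun, not_lt.2 h2.le, h1.le]

open Classical in
/-- The coefficient of the `i`-th B-spline over `X ∪ {t}` in the `i`-th B-spline over `X`. -/
noncomputable def insertL (X : KnotSeq) (t : ℝ) (p : ℕ) (i : ℤ) : ℝ :=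
  if X.knot i < t then
    if t < X.knot (i + p + 1) then
      (t - X.knot i) / ((X.insertKnot t).knot (i + p + 1) - X.knot i) else 1
  else 0

open Classical in
/-- The coefficient of the `(i + 1)`-st B-spline over `X ∪ {t}` in the `i`-th B-spline
over `X`. -/
noncomputable def insertR (X : KnotSeq) (t : ℝ) (p : ℕ) (i : ℤ) : ℝ :=
  if t < X.knot (i + p + 1) then
    if X.knot i < t then
      (X.knot (i + p + 1) - t) / (X.knot (i + p + 1) - (X.insertKnot t).knot (i + 1)) else 1
  else 0

theorem knot_lt_insertKnot_knot (ht : t ∉ range X.knot) {i j : ℤ} (hi : X.knot i < t) (h : i < j) :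
    X.knot i < (X.insertKnot t).knot j := by
  rw [← insertKnot_knot_of_lt ht hi]
  exact (X.insertKnot t).strictMono h

theorem insertKnot_knot_lt_knot (ht : t ∉ range X.knot) {i j : ℤ} (hi : t < X.knot i)
    (h : j ≤ i) : (X.insertKnot t).knot j < X.knot i := by
  have : X.knot i = (X.insertKnot t).knot (i + 1) := by
    rw [insertKnot_knot_of_gt ht] <;> simp [hi]
  rw [this]
  exact (X.insertKnot t).strictMono (by omega)

theorem insertL_nonneg (ht : t ∉ range X.knot) (p : ℕ) (i : ℤ) : 0 ≤ X.insertL t p i := by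
  unfold insertL
  split_ifs with h1 h2
  · exact div_nonneg (sub_nonneg.2 h1.le)
      (sub_nonneg.2 (knot_lt_insertKnot_knot ht h1 (by omega)).le)
  · exact zero_le_one
  · exact le_rfl

theorem insertR_nonneg (ht : t ∉ range X.knot) (p : ℕ) (i : ℤ) : 0 ≤ X.insertR t p i := by
  unfold insertR
  split_ifs with h1 h2
  · exact div_nonneg (sub_nonneg.2 h1.le)
      (sub_nonneg.2 (insertKnot_knot_lt_knot ht h1 (by omega)).le)
  · exact zero_le_one
  · exact le_rfl

theorem insertL_pos (ht : t ∉ range X.knot) (p : ℕ) {i : ℤ} (h1 : X.knot i < t) :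
    0 < X.insertL t p i := by
  unfold insertL
  rw [if_pos h1]
  split_ifs with h2
  · exact div_pos (sub_pos.2 h1) (sub_pos.2 (knot_lt_insertKnot_knot ht h1 (by omega)))
  · exact zero_lt_one

theorem insertR_pos (ht : t ∉ range X.knot) (p : ℕ) {i : ℤ} (h1 : t < X.knot (i + p + 1)) :
    0 < X.insertR t p i := by
  unfold insertR
  rw [if_pos h1]
  split_ifs with h2
  · exact div_pos (sub_pos.2 h1) (sub_pos.2 (insertKnot_knot_lt_knot ht h1 (by omega)))
  · exact zero_lt_one

theorem bspline_insertKnot_zero (ht : t ∉ range X.knot) (i : ℤ) (x : ℝ) :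
    X.bspline 0 i x = X.insertL t 0 i * (X.insertKnot t).bspline 0 i x +
      X.insertR t 0 i * (X.insertKnot t).bspline 0 (i + 1) x := by
  have hlt : X.knot i < X.knot (i + 1) := X.strictMono (by omega)
  have hlt2 : X.knot (i + 1) < X.knot (i + 1 + 1) := X.strictMono (by omega)
  have n1 : X.knot i ≠ t := fun h => ht ⟨_, h⟩
  have n2 : X.knot (i + 1) ≠ t := fun h => ht ⟨_, h⟩
  rcases lt_or_gt_of_ne n1 with h1 | h1
  · have y0 := insertKnot_knot_of_lt ht h1
    rcases lt_or_gt_of_ne n2 with h2 | h2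
    · have y1 := insertKnot_knot_of_lt ht h2
      simp [insertL, insertR, h1, not_lt.2 h2.le, bspline, y0, y1]
    · have y1 : (X.insertKnot t).knot (i + 1) = t :=
        insertKnot_knot_of_mem ht (by simpa using h1) h2
      have y2 : (X.insertKnot t).knot (i + 1 + 1) = X.knot (i + 1) := by
        rw [insertKnot_knot_of_gt ht] <;> simp [h2]
      have d1 : t - X.knot i ≠ 0 := (sub_pos.2 h1).ne'
      have d2 : X.knot (i + 1) - t ≠ 0 := (sub_pos.2 h2).ne'
      simp only [insertL, insertR, h1, h2, bspline, y0, y1, y2, Nat.cast_zero, add_zero, if_true,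
        div_self d1, div_self d2, indicator, mem_Ico, one_mul]
      by_cases hx : x < t
      · by_cases hx' : X.knot i ≤ x
        · simp [hx, hx', not_le.2 hx, hx.trans h2]
        · simp [hx', not_le.2 hx]
      · have := h1.le.trans (not_lt.1 hx)
        simp [hx, not_lt.1 hx, this]
  · have h2 := h1.trans hlt
    have y1 : (X.insertKnot t).knot (i + 1) = X.knot i := by
      rw [insertKnot_knot_of_gt ht] <;> simp [h1]
    have y2 : (X.insertKnot t).knot (i + 1 + 1) = X.knot (i + 1) := by
      rw [insertKnot_knot_of_gt ht] <;> simp [h2]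
    simp [insertL, insertR, not_lt.2 h1.le, h2, bspline, y1, y2]

/-- Boehm's knot insertion formula. The Cox–de Boor recursion on both sides reduces it to the three
new B-splines of one degree less, whose coefficients are compared according to the position of `t`.
-/
theorem bspline_insertKnot (ht : t ∉ range X.knot) (p : ℕ) (i : ℤ) (x : ℝ) :
    X.bspline p i x = X.insertL t p i * (X.insertKnot t).bspline p i x +
      X.insertR t p i * (X.insertKnot t).bspline p (i + 1) x := by
  induction p generalizing i with
  | zero => exact bspline_insertKnot_zero ht i x
  | succ p ih =>
    have e1 : i + ((p + 1 : ℕ) : ℤ) + 1 = i + p + 2 := by push_cast; ring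
    have e2 : i + 1 + (p : ℤ) + 1 = i + p + 2 := by ring
    have e3 : i + 1 + (p : ℤ) + 2 = i + p + 3 := by ring
    have l1 : X.knot i < X.knot (i + 1) := X.strictMono (by omega)
    have l2 : X.knot (i + 1) ≤ X.knot (i + p + 1) := X.strictMono.monotone (by omega)
    have l3 : X.knot (i + p + 1) < X.knot (i + p + 2) := X.strictMono (by omega)
    have n0 : X.knot i ≠ t := fun h => ht ⟨_, h⟩
    have n1 : X.knot (i + 1) ≠ t := fun h => ht ⟨_, h⟩
    have n2 : X.knot (i + p + 1) ≠ t := fun h => ht ⟨_, h⟩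
    have n3 : X.knot (i + p + 2) ≠ t := fun h => ht ⟨_, h⟩
    have yl : ∀ k, X.knot k < t → (X.insertKnot t).knot k = X.knot k :=
      fun k hk => insertKnot_knot_of_lt ht hk
    have yr : ∀ k, t < X.knot k → (X.insertKnot t).knot (k + 1) = X.knot k := fun k hk => by
      rw [insertKnot_knot_of_gt ht] <;> simp [hk]
    have ym : ∀ k, X.knot k < t → t < X.knot (k + 1) → (X.insertKnot t).knot (k + 1) = t :=
      fun k hk hk' => insertKnot_knot_of_mem ht (by simpa using hk) hk'
    have m1 := (X.insertKnot t).strictMono (show i < i + p + 1 by omega)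
    have m2 := (X.insertKnot t).strictMono (show i + 1 < i + p + 2 by omega)
    have m3 := (X.insertKnot t).strictMono (show i + 1 + 1 < i + p + 3 by omega)
    rw [bspline, ih i, ih (i + 1), bspline, bspline]
    simp only [insertL, insertR, e1, e2, e3] at *
    -- The three B-splines can be treated as independent variables: from here on the identity is one
    -- of rational functions in the knots.
    generalize (X.insertKnot t).bspline p i x = b0
    generalize (X.insertKnot t).bspline p (i + 1) x = b1
    generalize (X.insertKnot t).bspline p (i + 1 + 1) x = b2
    have a2 : i + p + 1 + 1 = i + p + 2 := by ring
    have a3 : i + p + 2 + 1 = i + p + 3 := by ring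
    have yr1 := yr (i + p + 1)
    have ym1 := ym (i + p + 1)
    have yr2 := yr (i + p + 2)
    rw [a2] at yr1 ym1
    rw [a3] at yr2
    rcases lt_or_gt_of_ne n0 with h0 | h0
    · rw [yl _ h0] at *
      rcases lt_or_gt_of_ne n1 with h1 | h1
      · rw [yl _ h1] at *
        rcases lt_or_gt_of_ne n2 with h2 | h2
        · rw [yl _ h2] at *
          rcases lt_or_gt_of_ne n3 with h3 | h3
          · rw [yl _ h3] at *
            simp [h0, h1, not_lt.2 h2.le, not_lt.2 h3.le]
          · rw [ym1 h2 h3, yr2 h3] at *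
            simp only [h0, h1, not_lt.2 h2.le, h3, if_true, if_false]
            have := sub_pos.2 h0; have := sub_pos.2 h1; have := sub_pos.2 h3
            have := sub_pos.2 m3; have := sub_pos.2 l3; have := sub_pos.2 m1
            have : 0 < X.knot (i + p + 2) - X.knot (i + 1) := by linarith
            have : 0 < X.knot (i + p + 2) - X.knot i := by linarith
            field_simp
            ring
        · have h3 := h2.trans l3
          rw [yr1 h2, yr2 h3] at *
          simp only [h0, h1, h2, h3, if_true]
          have : 0 < X.knot (i + p + 1) - X.knot (i + 1) := by linarith
          have : 0 < X.knot (i + p + 1) - X.knot i := by linarith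
          have : 0 < X.knot (i + p + 2) - X.knot (i + 1) := by linarith
          have := sub_pos.2 m3; have := sub_pos.2 m1
          field_simp
          ring
      · have h2 := h1.trans_le l2
        have h3 := h2.trans l3
        rw [ym _ h0 h1, yr _ h1, yr1 h2, yr2 h3] at *
        simp only [h0, h2, not_lt.2 h1.le, h3, if_true, if_false]
        have := sub_pos.2 h0; have := sub_pos.2 h1; have := sub_pos.2 h3; have := sub_pos.2 h2
        have := sub_pos.2 m3; have := sub_pos.2 l3; have := sub_pos.2 m1
        have : 0 < X.knot (i + p + 1) - X.knot i := by linarith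
        have : 0 < X.knot (i + p + 2) - X.knot (i + 1) := by linarith
        field_simp
        ring
    · have h1 := h0.trans l1
      have h2 := h1.trans_le l2
      have h3 := h2.trans l3
      rw [yr _ h0, yr _ h1, yr1 h2, yr2 h3]
      simp [not_lt.2 h0.le, not_lt.2 h1.le, h2, h3]

end KnotSeq

/-! ### Cones of B-splines and parents under knot insertion. -/

namespace KnotSeq

/-- The cone spanned by the B-splines of degree `p` over `X` with support in `[u, v]`. -/
def cone (X : KnotSeq) (p : ℕ) (u v : ℝ) : Submodule ℝ≥0 (ℝ → ℝ) :=
  Submodule.span ℝ≥0 {f | ∃ j, u ≤ X.knot j ∧ X.knot (j + p + 1) ≤ v ∧ f = X.bspline p j}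

variable {X Y : KnotSeq} {p : ℕ} {u v : ℝ}

theorem bspline_mem_cone {j : ℤ} (h1 : u ≤ X.knot j) (h2 : X.knot (j + p + 1) ≤ v) :
    X.bspline p j ∈ X.cone p u v :=
  Submodule.subset_span ⟨j, h1, h2, rfl⟩

/-- The `k`-th B-spline over `Y` occurs with a positive coefficient in a representation of the
`r`-th B-spline over `X`. -/
def IsParent (X Y : KnotSeq) (p : ℕ) (r k : ℤ) : Prop :=
  ∃ α : ℝ≥0, 0 < α ∧ ∃ g ∈ Y.cone p (X.knot r) (X.knot (r + p + 1)),
    X.bspline p r = α • Y.bspline p k + g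

theorem isParent_self (X : KnotSeq) (p : ℕ) (k : ℤ) : IsParent X X p k k :=
  ⟨1, one_pos, 0, Submodule.zero_mem _, by simp⟩

variable {t : ℝ}

/-- The coefficient has to be included: when `t` lies to the left of the old support, the new
B-spline sticks out of it, but then its coefficient is zero. -/
theorem insertL_smul_mem (ht : t ∉ range X.knot) (i : ℤ) :
    (⟨_, insertL_nonneg ht p i⟩ : ℝ≥0) • (X.insertKnot t).bspline p i ∈
      (X.insertKnot t).cone p (X.knot i) (X.knot (i + p + 1)) := by
  by_cases h : X.knot i < t
  · refine Submodule.smul_mem _ _ (bspline_mem_cone (insertKnot_knot_of_lt ht h).ge ?_)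
    rw [insertKnot_knot_eq_ite ht]
    split_ifs with h'
    · exact le_rfl
    · exact max_le (not_lt.1 h') (X.strictMono.monotone (by omega))
  · convert Submodule.zero_mem _
    ext x
    simp [insertL, h]

theorem insertR_smul_mem (ht : t ∉ range X.knot) (i : ℤ) :
    (⟨_, insertR_nonneg ht p i⟩ : ℝ≥0) • (X.insertKnot t).bspline p (i + 1) ∈
      (X.insertKnot t).cone p (X.knot i) (X.knot (i + p + 1)) := by
  by_cases h : t < X.knot (i + p + 1)
  · refine Submodule.smul_mem _ _ (bspline_mem_cone ?_ ?_)
    · rw [insertKnot_knot_eq_ite ht]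
      split_ifs with h'
      · exact X.strictMono.monotone (by omega)
      · exact le_max_of_le_right (X.strictMono.monotone (by omega))
    · rw [insertKnot_knot_of_gt ht]
      · exact X.strictMono.monotone (by omega)
      · convert h using 2; ring
  · convert Submodule.zero_mem _
    ext x
    simp [insertR, h]

theorem bspline_insertKnot_smul (ht : t ∉ range X.knot) (i : ℤ) :
    X.bspline p i = (⟨_, insertL_nonneg ht p i⟩ : ℝ≥0) • (X.insertKnot t).bspline p i +
      (⟨_, insertR_nonneg ht p i⟩ : ℝ≥0) • (X.insertKnot t).bspline p (i + 1) := by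
  ext x
  exact bspline_insertKnot ht p i x

theorem isParent_left (ht : t ∉ range X.knot) {i : ℤ} (h : X.knot i < t) :
    IsParent X (X.insertKnot t) p i i :=
  ⟨_, insertL_pos ht p h, _, insertR_smul_mem ht i, bspline_insertKnot_smul ht i⟩

theorem isParent_right (ht : t ∉ range X.knot) {i : ℤ} (h : t < X.knot (i + p + 1)) :
    IsParent X (X.insertKnot t) p i (i + 1) :=
  ⟨_, insertR_pos ht p h, _, insertL_smul_mem ht i,
    (bspline_insertKnot_smul ht i).trans (add_comm _ _)⟩

/-- Every B-spline over `X ∪ {t}` has a parent over `X` whose support touches the same cells of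
`X`, or two parents, the supports of which extend its support by one cell to the left and to
the right. -/
theorem exists_isParent (X : KnotSeq) (t : ℝ) (p : ℕ) (k : ℤ) :
    (∃ r, IsParent X (X.insertKnot t) p r k ∧ X.knot r ≤ (X.insertKnot t).knot k ∧
      (X.insertKnot t).knot k < X.knot (r + 1) ∧
      X.knot (r + p) < (X.insertKnot t).knot (k + p + 1) ∧
      (X.insertKnot t).knot (k + p + 1) ≤ X.knot (r + p + 1)) ∨
    ((X.insertKnot t).knot k = X.knot k ∧ (X.insertKnot t).knot (k + p + 1) = X.knot (k + p) ∧
      IsParent X (X.insertKnot t) p (k - 1) k ∧ IsParent X (X.insertKnot t) p k k) := by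
  by_cases ht : t ∈ range X.knot
  · have : X.insertKnot t = X := dif_pos ht
    rw [this]
    exact Or.inl ⟨k, isParent_self X p k, le_rfl, X.strictMono (by omega),
      X.strictMono (by omega), le_rfl⟩
  · have n0 : X.knot k ≠ t := fun h => ht ⟨_, h⟩
    have n1 : X.knot (k + p) ≠ t := fun h => ht ⟨_, h⟩
    have e : k + (p : ℤ) + 1 - 1 = k + p := by ring
    have l0 : X.knot (k - 1) < X.knot k := X.strictMono (by omega)
    have l1 : X.knot k ≤ X.knot (k + p) := X.strictMono.monotone (by omega)
    have l2 : X.knot (k + p) < X.knot (k + p + 1) := X.strictMono (by omega)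
    have l3 : X.knot (k - 1 + p) < X.knot (k + p) := X.strictMono (by omega)
    have e2 : k - 1 + (p : ℤ) + 1 = k + p := by ring
    have right : t < X.knot (k + p) → IsParent X (X.insertKnot t) p (k - 1) k := fun h => by
      have := isParent_right (p := p) (i := k - 1) ht (by rwa [e2])
      rwa [sub_add_cancel] at this
    have hv : t < X.knot (k + p) → (X.insertKnot t).knot (k + p + 1) = X.knot (k + p) :=
      fun h => by rw [insertKnot_knot_of_gt ht, e]; rwa [e]
    -- Two parents occur only if `t` lies between `X.knot k` and `X.knot (k + p)`, hence inside the
    -- new support, whose ends are then these old knots. To the right of that interval the parent is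
    -- `k`, to the left it is `k - 1`.
    rcases lt_or_gt_of_ne n0 with h0 | h0
    · rcases lt_or_gt_of_ne n1 with h1 | h1
      · refine Or.inl ⟨k, isParent_left ht h0, (insertKnot_knot_of_lt ht h0).ge, ?_, ?_, ?_⟩
        · rw [insertKnot_knot_of_lt ht h0]; exact X.strictMono (by omega)
        · rw [insertKnot_knot_eq_ite ht, e]
          split_ifs with h
          · exact l2
          · exact lt_max_of_lt_left h1
        · rw [insertKnot_knot_eq_ite ht, e]
          split_ifs with h
          · exact le_rfl
          · exact max_le (not_lt.1 h) l2.le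
      · exact Or.inr ⟨insertKnot_knot_of_lt ht h0, hv h1, right h1, isParent_left ht h0⟩
    · have h1 := h0.trans_le l1
      refine Or.inl ⟨k - 1, right h1, ?_, ?_, ?_, ?_⟩
      · rw [insertKnot_knot_eq_ite ht, if_neg (not_lt.2 h0.le)]
        exact le_max_right _ _
      · rw [insertKnot_knot_eq_ite ht, if_neg (not_lt.2 h0.le), sub_add_cancel]
        exact max_lt h0 l0
      · rw [hv h1]; exact l3
      · rw [hv h1, e2]

/-- Without further nodes of `Y` in between, consecutive nodes of `X` are consecutive in `Y`; by
`bspline_congr` the B-splines then coincide. This is the base case for repeated knot insertion. -/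
theorem exists_shift_of_forall_notMem (hXY : range X.knot ⊆ range Y.knot) (i : ℤ) (p : ℕ)
    (h : ∀ s ∈ range Y.knot, X.knot i < s → s < X.knot (i + p) → s ∈ range X.knot) :
    ∃ j, ∀ r : ℕ, r ≤ p → X.knot (i + r) = Y.knot (j + r) := by
  induction p with
  | zero =>
    obtain ⟨j, hj⟩ := hXY ⟨i, rfl⟩
    exact ⟨j, fun r hr => by obtain rfl : r = 0 := by omega
                             simpa using hj.symm⟩
  | succ p ih =>
    obtain ⟨j, hj⟩ := ih fun s h1 h2 h3 => h s h1 h2 (h3.trans (X.strictMono (by simp)))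
    refine ⟨j, fun r hr => ?_⟩
    rcases Nat.lt_or_ge p r with h' | h'
    · obtain rfl : r = p + 1 := by omega
      have hp := hj p le_rfl
      obtain ⟨k, hk⟩ := hXY ⟨i + (p + 1 : ℕ), rfl⟩
      rw [← hk]
      congr 1
      have l1 : j + p < k := by
        rw [← Y.knot_lt_iff, ← hp, hk]; exact X.strictMono (by simp)
      by_contra hne
      have l2 : j + p + 1 < k := by push_cast at hne; omega
      have l3 : X.knot i ≤ X.knot (i + p) := X.strictMono.monotone (by omega)
      have l4 : X.knot (i + p) < Y.knot (j + p + 1) := by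
        rw [hp]; exact Y.strictMono (by omega)
      have l5 : Y.knot (j + p + 1) < X.knot (i + (p + 1 : ℕ)) := by
        rw [← hk]; exact Y.strictMono l2
      obtain ⟨q, hq⟩ := h _ ⟨_, rfl⟩ (l3.trans_lt l4) l5
      rw [← hq, knot_lt_iff] at l4 l5
      push_cast at l5
      omega
    · exact hj r h'

theorem finite_range_inter_Ioo (X : KnotSeq) (u v : ℝ) : (range X.knot ∩ Ioo u v).Finite := by
  obtain ⟨a, ha⟩ := (X.tendsto_atBot.eventually_lt_atBot u).exists
  obtain ⟨b, hb⟩ := (X.tendsto_atTop.eventually_gt_atTop v).exists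
  refine ((finite_Icc a b).image X.knot).subset ?_
  rintro _ ⟨⟨i, rfl⟩, h1, h2⟩
  exact ⟨i, ⟨(X.knot_lt_iff.1 (ha.trans h1)).le, (X.knot_lt_iff.1 (h2.trans hb)).le⟩, rfl⟩

/-- A B-spline is a non-negative combination of the B-splines over a finer grid with smaller
support. -/
theorem bspline_mem_cone_of_range_subset (hXY : range X.knot ⊆ range Y.knot) (p : ℕ) (i : ℤ) :
    X.bspline p i ∈ Y.cone p (X.knot i) (X.knot (i + p + 1)) := by
  -- The induction runs over the number of missing nodes in a fixed window. The window does not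
  -- shrink with the supports, so each inserted node lowers the bound for both resulting B-splines.
  suffices H : ∀ (c : ℕ) (X : KnotSeq) (i : ℤ) (u v : ℝ), range X.knot ⊆ range Y.knot →
      u ≤ X.knot i → X.knot (i + p + 1) ≤ v → ((range Y.knot \ range X.knot) ∩ Ioo u v).ncard ≤ c →
      X.bspline p i ∈ Y.cone p u v from
    H _ X i _ _ hXY le_rfl le_rfl le_rfl
  intro c
  induction c with
  | zero =>
    intro X i u v hXY hu hv hc
    have hfin : ((range Y.knot \ range X.knot) ∩ Ioo u v).Finite :=
      (Y.finite_range_inter_Ioo u v).subset (inter_subset_inter_left _ sdiff_subset)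
    have hemp := (ncard_eq_zero hfin).1 (Nat.le_zero.1 hc)
    obtain ⟨j, hj⟩ := exists_shift_of_forall_notMem hXY i (p + 1) fun s h1 h2 h3 => by
      by_contra hs
      have : s ∈ (range Y.knot \ range X.knot) ∩ Ioo u v :=
        ⟨⟨h1, hs⟩, hu.trans_lt h2, lt_of_lt_of_le h3 (by push_cast; rwa [← add_assoc])⟩
      rw [hemp] at this
      exact this
    rw [bspline_congr X Y p i j hj]
    have h0 := hj 0 (by omega)
    have h1 := hj (p + 1) le_rfl
    push_cast at h0 h1
    simp only [add_zero, ← add_assoc] at h0 h1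
    exact bspline_mem_cone (h0 ▸ hu) (h1 ▸ hv)
  | succ c ih =>
    intro X i u v hXY hu hv hc
    have hfin : ((range Y.knot \ range X.knot) ∩ Ioo u v).Finite :=
      (Y.finite_range_inter_Ioo u v).subset (inter_subset_inter_left _ sdiff_subset)
    by_cases hemp : ((range Y.knot \ range X.knot) ∩ Ioo u v) = ∅
    · exact ih X i u v hXY hu hv (by simp [hemp])
    · obtain ⟨t, ⟨htY, ht⟩, htu⟩ := nonempty_iff_ne_empty.2 hemp
      have hr := X.range_insertKnot t
      have hsub : range (X.insertKnot t).knot ⊆ range Y.knot := by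
        rw [hr]; exact insert_subset htY hXY
      have hlt : ((range Y.knot \ range (X.insertKnot t).knot) ∩ Ioo u v).ncard ≤ c := by
        refine Nat.le_of_lt_succ (lt_of_lt_of_le (ncard_lt_ncard ?_ hfin) hc)
        rw [hr]
        refine ⟨fun s hs => ⟨⟨hs.1.1, fun h => hs.1.2 (Or.inr h)⟩, hs.2⟩, fun h => ?_⟩
        exact (h ⟨⟨htY, ht⟩, htu⟩).1.2 (Or.inl rfl)
      have key : (X.insertKnot t).cone p (X.knot i) (X.knot (i + p + 1)) ≤ Y.cone p u v := by
        refine Submodule.span_le.2 ?_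
        rintro _ ⟨j, h1, h2, rfl⟩
        exact ih _ j u v hsub (hu.trans h1) (h2.trans hv) hlt
      rw [bspline_insertKnot_smul ht]
      exact Submodule.add_mem _ (key (insertL_smul_mem ht i)) (key (insertR_smul_mem ht i))

end KnotSeq

/-! ### Offset conditions as extendability of free blocks. -/

theorem mem_dilH_iterate (k : ℕ) (S : Set (ℤ × ℤ)) (p q : ℤ) :
    (p, q) ∈ dilH^[k] S ↔ ∃ a, p - k ≤ a ∧ a ≤ p ∧ (a, q) ∈ S := by
  induction k generalizing p with
  | zero =>
    refine ⟨fun h => ⟨p, by simp, le_rfl, h⟩, fun ⟨a, h1, h2, h3⟩ => ?_⟩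
    obtain rfl : a = p := by push_cast at h1; omega
    exact h3
  | succ k ih =>
    rw [Function.iterate_succ_apply', dilH, mem_ofPred_eq, ih, ih]
    constructor
    · rintro (⟨a, h1, h2, h3⟩ | ⟨a, h1, h2, h3⟩)
      · exact ⟨a, by push_cast; omega, h2, h3⟩
      · exact ⟨a, by push_cast; omega, by omega, h3⟩
    · rintro ⟨a, h1, h2, h3⟩
      push_cast at h1
      by_cases h : p - k ≤ a
      · exact Or.inl ⟨a, h, h2, h3⟩
      · exact Or.inr ⟨a, by omega, by omega, h3⟩

theorem mem_dilV_iterate (k : ℕ) (S : Set (ℤ × ℤ)) (p q : ℤ) :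
    (p, q) ∈ dilV^[k] S ↔ ∃ b, q - k ≤ b ∧ b ≤ q ∧ (p, b) ∈ S := by
  induction k generalizing q with
  | zero =>
    refine ⟨fun h => ⟨q, by simp, le_rfl, h⟩, fun ⟨a, h1, h2, h3⟩ => ?_⟩
    obtain rfl : a = q := by push_cast at h1; omega
    exact h3
  | succ k ih =>
    rw [Function.iterate_succ_apply', dilV, mem_ofPred_eq, ih, ih]
    constructor
    · rintro (⟨a, h1, h2, h3⟩ | ⟨a, h1, h2, h3⟩)
      · exact ⟨a, by push_cast; omega, h2, h3⟩
      · exact ⟨a, by push_cast; omega, by omega, h3⟩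
    · rintro ⟨a, h1, h2, h3⟩
      push_cast at h1
      by_cases h : q - k ≤ a
      · exact Or.inl ⟨a, h, h2, h3⟩
      · exact Or.inr ⟨a, by omega, by omega, h3⟩

/-- No cell of `S` has its indices in `[a, b) × [c, d)`. -/
def AvoidsBlock (S : Set (ℤ × ℤ)) (a b c d : ℤ) : Prop :=
  ∀ i j, a ≤ i → i < b → c ≤ j → j < d → (i, j) ∉ S

/-- This translates dilatations into blocks: a cell is missing from the dilated set iff a whole
block of (k₁ + 1) × (k₂ + 1) cells is missing from `S`. -/
theorem notMem_dil (k₁ k₂ : ℕ) (S : Set (ℤ × ℤ)) (p q : ℤ) :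
    (p, q) ∉ dil k₁ k₂ S ↔ AvoidsBlock S (p - k₁) (p + 1) (q - k₂) (q + 1) := by
  rw [dil, mem_dilH_iterate]
  simp only [mem_dilV_iterate]
  constructor
  · intro h i j h1 h2 h3 h4 h5
    exact h ⟨i, h1, by omega, j, h3, by omega, h5⟩
  · rintro h ⟨a, h1, h2, b, h3, h4, h5⟩
    exact h a b h1 (by omega) h3 (by omega) h5

/-- Otherwise the two neighbours would bound a gap of exactly one cell. -/
theorem OffsetClass1.notMem_or {D : Set ℤ} (h : OffsetClass1 1 D) {p : ℤ} (hp : p ∉ D) :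
    p - 1 ∉ D ∨ p + 1 ∉ D := by
  by_contra! hcon
  have := h.2 _ hcon.1 _ hcon.2 (by omega) fun c h1 h2 => by
    obtain rfl : c = p := by omega
    exact hp
  push_cast at this
  omega

theorem OffsetClass2.hOffset {k₁ k₂ : ℕ} {S : Set (ℤ × ℤ)} (h : OffsetClass2 k₁ k₂ S) {i : ℕ}
    (hi : i < k₁) : HOffset (dil i k₂ S) := by
  induction k₁ with
  | zero => omega
  | succ k ih =>
    rw [OffsetClass2] at h
    rcases Nat.lt_or_ge i k with h' | h'
    · exact ih h.1 h'
    · obtain rfl : i = k := by omega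
      exact h.2

theorem OffsetClass2.vOffset {k₁ k₂ : ℕ} {S : Set (ℤ × ℤ)} (h : OffsetClass2 k₁ k₂ S) {j : ℕ}
    (hj : j < k₂) : VOffset (dil 0 j S) := by
  induction k₁ with
  | zero =>
    induction k₂ with
    | zero => omega
    | succ k ih =>
      rw [OffsetClass2] at h
      rcases Nat.lt_or_ge j k with h' | h'
      · exact ih h' h.1
      · obtain rfl : j = k := by omega
        exact h.2
  | succ k ih =>
    rw [OffsetClass2] at h
    exact ih h.1

/-- A block that avoids `S` can be extended by one column. -/
def ExtendsH (S : Set (ℤ × ℤ)) (a b c d : ℤ) : Prop :=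
  AvoidsBlock S a b c d → AvoidsBlock S (a - 1) b c d ∨ AvoidsBlock S a (b + 1) c d

/-- A block that avoids `S` can be extended by one row. -/
def ExtendsV (S : Set (ℤ × ℤ)) (a b c d : ℤ) : Prop :=
  AvoidsBlock S a b c d → AvoidsBlock S a b (c - 1) d ∨ AvoidsBlock S a b c (d + 1)

theorem AvoidsBlock.mono {S : Set (ℤ × ℤ)} {a b c d a' b' c' d' : ℤ} (h : AvoidsBlock S a b c d)
    (ha : a ≤ a') (hb : b' ≤ b) (hc : c ≤ c') (hd : d' ≤ d) : AvoidsBlock S a' b' c' d' :=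
  fun i j h1 h2 h3 h4 => h i j (by omega) (by omega) (by omega) (by omega)

section

variable {k₁ k₂ : ℕ} {S : Set (ℤ × ℤ)}

/-- A free block is a missing cell of the dilatation, and a missing neighbour of that cell is the
block shifted by one column. Blocks with one more row correspond to the union of two consecutive
rows, that is, to the intersection with a grid line. -/
theorem HOffset.extendsH (h : HOffset (dil k₁ k₂ S)) {a b c d : ℤ} (hab : b = a + k₁ + 1)
    (hcd : d = c + k₂ + 1 ∨ d = c + k₂ + 2) : ExtendsH S a b c d := by
  intro hav
  subst hab
  rcases hcd with rfl | rfl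
  · have h1 : a + k₁ ∉ rowOf (dil k₁ k₂ S) (c + k₂) := by
      refine (notMem_dil _ _ _ _ _).2 (hav.mono ?_ ?_ ?_ ?_) <;> omega
    rcases (h.2 _).1.notMem_or h1 with h2 | h2
    · left
      have h3 := (notMem_dil _ _ _ _ _).1 h2
      intro i j g1 g2 g3 g4
      by_cases g : i = a + k₁
      · exact hav i j (by omega) (by omega) (by omega) (by omega)
      · exact h3 i j (by omega) (by omega) (by omega) (by omega)
    · right
      have h3 := (notMem_dil _ _ _ _ _).1 h2
      intro i j g1 g2 g3 g4
      by_cases g : i = a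
      · exact hav i j (by omega) (by omega) (by omega) (by omega)
      · exact h3 i j (by omega) (by omega) (by omega) (by omega)
  · have h1 : a + k₁ ∉ rowOf (dil k₁ k₂ S) (c + k₂) ∪ rowOf (dil k₁ k₂ S) (c + k₂ + 1) := by
      rintro (h1 | h1) <;> revert h1 <;>
        refine (notMem_dil _ _ _ _ _).2 (hav.mono ?_ ?_ ?_ ?_) <;> omega
    rcases (h.2 _).2.notMem_or h1 with h2 | h2
    · left
      have h3 := (notMem_dil _ _ _ _ _).1 (fun h3 => h2 (Or.inl h3))
      have h4 := (notMem_dil _ _ _ _ _).1 (fun h3 => h2 (Or.inr h3))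
      intro i j g1 g2 g3 g4
      by_cases g : i = a + k₁
      · exact hav i j (by omega) (by omega) (by omega) (by omega)
      · by_cases g' : j = c
        · exact h3 i j (by omega) (by omega) (by omega) (by omega)
        · exact h4 i j (by omega) (by omega) (by omega) (by omega)
    · right
      have h3 := (notMem_dil _ _ _ _ _).1 (fun h3 => h2 (Or.inl h3))
      have h4 := (notMem_dil _ _ _ _ _).1 (fun h3 => h2 (Or.inr h3))
      intro i j g1 g2 g3 g4
      by_cases g : i = a
      · exact hav i j (by omega) (by omega) (by omega) (by omega)
      · by_cases g' : j = c
        · exact h3 i j (by omega) (by omega) (by omega) (by omega)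
        · exact h4 i j (by omega) (by omega) (by omega) (by omega)

theorem VOffset.extendsV (h : VOffset (dil 0 k₂ S)) {a b c d : ℤ} (hab : b = a + 1 ∨ b = a + 2)
    (hcd : d = c + k₂ + 1) : ExtendsV S a b c d := by
  intro hav
  subst hcd
  rcases hab with rfl | rfl
  · have h1 : c + k₂ ∉ colOf (dil 0 k₂ S) a := by
      refine (notMem_dil _ _ _ _ _).2 (hav.mono ?_ ?_ ?_ ?_) <;> omega
    rcases (h.2 _).1.notMem_or h1 with h2 | h2
    · left
      have h3 := (notMem_dil _ _ _ _ _).1 h2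
      intro i j g1 g2 g3 g4
      by_cases g : j = c + k₂
      · exact hav i j (by omega) (by omega) (by omega) (by omega)
      · exact h3 i j (by omega) (by omega) (by omega) (by omega)
    · right
      have h3 := (notMem_dil _ _ _ _ _).1 h2
      intro i j g1 g2 g3 g4
      by_cases g : j = c
      · exact hav i j (by omega) (by omega) (by omega) (by omega)
      · exact h3 i j (by omega) (by omega) (by omega) (by omega)
  · have h1 : c + k₂ ∉ colOf (dil 0 k₂ S) a ∪ colOf (dil 0 k₂ S) (a + 1) := by
      rintro (h1 | h1) <;> revert h1 <;>
        refine (notMem_dil _ _ _ _ _).2 (hav.mono ?_ ?_ ?_ ?_) <;> omega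
    rcases (h.2 _).2.notMem_or h1 with h2 | h2
    · left
      have h3 := (notMem_dil _ _ _ _ _).1 (fun h3 => h2 (Or.inl h3))
      have h4 := (notMem_dil _ _ _ _ _).1 (fun h3 => h2 (Or.inr h3))
      intro i j g1 g2 g3 g4
      by_cases g : j = c + k₂
      · exact hav i j (by omega) (by omega) (by omega) (by omega)
      · by_cases g' : i = a
        · exact h3 i j (by omega) (by omega) (by omega) (by omega)
        · exact h4 i j (by omega) (by omega) (by omega) (by omega)
    · right
      have h3 := (notMem_dil _ _ _ _ _).1 (fun h3 => h2 (Or.inl h3))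
      have h4 := (notMem_dil _ _ _ _ _).1 (fun h3 => h2 (Or.inr h3))
      intro i j g1 g2 g3 g4
      by_cases g : j = c
      · exact hav i j (by omega) (by omega) (by omega) (by omega)
      · by_cases g' : i = a
        · exact h3 i j (by omega) (by omega) (by omega) (by omega)
        · exact h4 i j (by omega) (by omega) (by omega) (by omega)

/-- Blocks of at most `n` rows that can be extended vertically can be extended to exactly
`n + 1` rows. -/
theorem exists_avoidsBlock_of_extendsV {a b : ℤ} {n : ℕ}
    (hV : ∀ c d : ℤ, c < d → d - c ≤ n → ExtendsV S a b c d) {c d : ℤ} (hcd : c < d)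
    (hn : d - c ≤ n + 1) (h : AvoidsBlock S a b c d) :
    ∃ c' d', c' ≤ c ∧ d ≤ d' ∧ d' - c' = n + 1 ∧ AvoidsBlock S a b c' d' := by
  obtain ⟨k, hk⟩ : ∃ k : ℕ, (k : ℤ) = n + 1 - (d - c) := ⟨(n + 1 - (d - c)).toNat, by omega⟩
  induction k generalizing c d with
  | zero => exact ⟨c, d, le_rfl, le_rfl, by omega, h⟩
  | succ k ih =>
    push_cast at hk
    rcases hV c d hcd (by omega) h with h' | h'
    · obtain ⟨c', d', h1, h2, h3⟩ := ih (by omega) (by omega) h' (by omega)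
      exact ⟨c', d', by omega, h2, h3⟩
    · obtain ⟨c', d', h1, h2, h3⟩ := ih (by omega) (by omega) h' (by omega)
      exact ⟨c', d', h1, by omega, h3⟩

/-- If the conditions `U` and `D` both fail in `[a, b)`, then they fail at places between which
both hold. -/
theorem exists_closest_failures {U D : ℤ → Prop} {a b : ℤ} (hU : ∃ s, a ≤ s ∧ s < b ∧ ¬ U s)
    (hD : ∃ t, a ≤ t ∧ t < b ∧ ¬ D t) :
    ∃ s t, a ≤ min s t ∧ max s t < b ∧ ¬ U s ∧ ¬ D t ∧
      ∀ r, min s t < r → r < max s t → U r ∧ D r := by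
  obtain ⟨s, hs1, hs2, hs3⟩ := hU
  obtain ⟨t, ht1, ht2, ht3⟩ := hD
  induction h : (max s t - min s t).toNat using Nat.strong_induction_on generalizing s t with
  | _ k ih =>
  by_cases hr : ∀ r, min s t < r → r < max s t → U r ∧ D r
  · exact ⟨s, t, by omega, by omega, hs3, ht3, hr⟩
  · push Not at hr
    obtain ⟨r, hr1, hr2, hr3⟩ := hr
    -- If `U` holds at `r`, then `D` fails there and `r` replaces `t`; otherwise `r` replaces `s`.
    -- Either way the failures move closer.
    by_cases hu : U r
    · exact ih _ (by omega) s hs1 hs2 hs3 r (by omega) (by omega) (hr3 hu) rfl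
    · exact ih _ (by omega) r (by omega) (by omega) hu t ht1 ht2 ht3 rfl

/-- The definition yields vertical extension only for one or two columns, and horizontal extension
only for `n + 1` or `n + 2` rows. For wider blocks, take a blocking cell above and one below, as
close as possible in the horizontal direction. The columns strictly between them are free above and
below, so a narrower, taller block fits there. Made tall enough by induction on the width, it
extends horizontally and runs into one of the blocking cells. -/
theorem OffsetClass2.extendsV {m n : ℕ} (h : OffsetClass2 m n S) {a b c d : ℤ} (hab : a < b)
    (hm : b - a ≤ m + 1) (hcd : c < d) (hn : d - c ≤ n) : ExtendsV S a b c d := by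
  induction hw : (b - a).toNat using Nat.strong_induction_on generalizing a b c d with
  | _ w ih =>
  intro hav
  by_contra! hcon
  obtain ⟨k₂, hk₂⟩ : ∃ k : ℕ, (k : ℤ) = d - c - 1 := ⟨(d - c - 1).toNat, by omega⟩
  have hoff := h.vOffset (j := k₂) (by omega)
  have hU : ∃ s, a ≤ s ∧ s < b ∧ ¬ (s, d) ∉ S := by
    by_contra! hU
    refine hcon.2 fun i j h1 h2 h3 h4 => ?_
    by_cases g : j = d
    · subst g; exact hU i h1 h2
    · exact hav i j h1 h2 h3 (by omega)
  have hD : ∃ s, a ≤ s ∧ s < b ∧ ¬ (s, c - 1) ∉ S := by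
    by_contra! hD
    refine hcon.1 fun i j h1 h2 h3 h4 => ?_
    by_cases g : j = c - 1
    · subst g; exact hD i h1 h2
    · exact hav i j h1 h2 (by omega) h4
  obtain ⟨s, t, h1, h2, hs, ht, hst⟩ :=
    exists_closest_failures (U := fun s => (s, d) ∉ S) (D := fun s => (s, c - 1) ∉ S) hU hD
  -- Blocking cells in equal or adjacent columns contradict the vertical offset condition for one or
  -- two columns.
  have hfar : max s t - min s t ≤ 1 → False := fun hle => by
    have hsub : AvoidsBlock S (min s t) (max s t + 1) c d :=
      hav.mono h1 (by omega) le_rfl le_rfl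
    rcases hoff.extendsV (by omega) (by omega) hsub with g | g
    · exact ht (g t (c - 1) (by omega) (by omega) (by omega) (by omega))
    · exact hs (g s d (by omega) (by omega) (by omega) (by omega))
  by_cases hle : max s t - min s t ≤ 1
  · exact hfar hle
  have hmid : AvoidsBlock S (min s t + 1) (max s t) (c - 1) (d + 1) := by
    intro i j g1 g2 g3 g4
    by_cases e1 : j = d
    · subst e1; exact (hst i (by omega) g2).1
    · by_cases e2 : j = c - 1
      · subst e2; exact (hst i (by omega) g2).2
      · exact hav i j (by omega) (by omega) (by omega) (by omega)
  -- The middle block has `d - c + 2` rows: this is `n + 2` if `d - c = n`, and otherwise at most `n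
  -- + 1`, so that the induction hypothesis can fill it up to `n + 1`.
  obtain ⟨c', d', hc', hd', hlen, hbig⟩ : ∃ c' d', c' ≤ c - 1 ∧ d + 1 ≤ d' ∧
      (d' - c' = n + 1 ∨ d' - c' = n + 2) ∧
      AvoidsBlock S (min s t + 1) (max s t) c' d' := by
    by_cases hlast : d - c = n
    · exact ⟨c - 1, d + 1, le_rfl, le_rfl, Or.inr (by omega), hmid⟩
    · obtain ⟨c', d', g1, g2, g3, g4⟩ := exists_avoidsBlock_of_extendsV (n := n)
        (fun c d hcd hn => ih (max s t - (min s t + 1)).toNat (by omega) (by omega) (by omega)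
          hcd hn rfl) (by omega) (by omega) hmid
      exact ⟨c', d', g1, g2, Or.inl g3, g4⟩
  obtain ⟨k₁, hk₁⟩ : ∃ k : ℕ, (k : ℤ) = max s t - min s t - 2 :=
    ⟨(max s t - min s t - 2).toNat, by omega⟩
  -- The additional column is that of `s` or of `t`, and the tall block contains both rows `c - 1`
  -- and `d`.
  rcases (h.hOffset (i := k₁) (by omega)).extendsH (by omega) (by omega) hbig with g | g
  · rcases le_total s t with e | e
    · exact hs (g s d (by omega) (by omega) (by omega) (by omega))
    · exact ht (g t (c - 1) (by omega) (by omega) (by omega) (by omega))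
  · rcases le_total s t with e | e
    · exact ht (g t (c - 1) (by omega) (by omega) (by omega) (by omega))
    · exact hs (g s d (by omega) (by omega) (by omega) (by omega))

/-- The horizontal condition needs at least `n + 1` rows. A lower block is first enlarged
vertically, then extended by a column and cut back to its own rows. -/
theorem OffsetClass2.extendsH {m n : ℕ} (h : OffsetClass2 m n S) {a b c d : ℤ} (hab : a < b)
    (hm : b - a ≤ m) (hcd : c < d) (hn : d - c ≤ n + 1) : ExtendsH S a b c d := by
  intro hav
  obtain ⟨c', d', h1, h2, h3, h4⟩ := exists_avoidsBlock_of_extendsV (n := n)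
    (fun c d hcd hn => h.extendsV hab (by omega) hcd hn) hcd hn hav
  obtain ⟨k₁, hk₁⟩ : ∃ k : ℕ, (k : ℤ) = b - a - 1 := ⟨(b - a - 1).toNat, by omega⟩
  rcases (h.hOffset (i := k₁) (by omega)).extendsH (by omega) (by omega) h4 with g | g
  · exact Or.inl (g.mono le_rfl le_rfl h1 h2)
  · exact Or.inr (g.mono le_rfl le_rfl h1 h2)

end

/-! ### Comparison of nested knot sequences. -/

namespace KnotSeq

variable {X Y : KnotSeq}

theorem exists_knot_le_lt (X : KnotSeq) (x : ℝ) : ∃ i, X.knot i ≤ x ∧ x < X.knot (i + 1) := by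
  obtain ⟨b, hb⟩ := (X.tendsto_atTop.eventually_gt_atTop x).exists
  obtain ⟨a, ha⟩ := (X.tendsto_atBot.eventually_le_atBot x).exists
  obtain ⟨k, hk1, hk2⟩ := Int.exists_greatest_of_bdd (P := fun k => X.knot k ≤ x)
    ⟨b, fun z hz => (X.knot_lt_iff.1 (hz.trans_lt hb)).le⟩ ⟨a, ha⟩
  refine ⟨k, hk1, ?_⟩
  by_contra hlt
  have := hk2 (k + 1) (not_lt.1 hlt)
  omega

theorem exists_knot_lt_le (X : KnotSeq) (x : ℝ) : ∃ i, X.knot (i - 1) < x ∧ x ≤ X.knot i := by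
  obtain ⟨k, h1, h2⟩ := X.exists_knot_le_lt x
  rcases h1.lt_or_eq with h | h
  · exact ⟨k + 1, by simpa using h, h2.le⟩
  · exact ⟨k, by rw [← h]; exact X.strictMono (by omega), h.ge⟩

theorem exists_strictMono_index (h : range X.knot ⊆ range Y.knot) :
    ∃ f : ℤ → ℤ, (∀ i, Y.knot (f i) = X.knot i) ∧ StrictMono f := by
  choose f hf using fun i => h ⟨i, rfl⟩
  exact ⟨f, hf, fun i j hij => by rw [← Y.knot_lt_iff, hf, hf]; exact X.strictMono hij⟩

theorem sub_le_sub_of_strictMono {f : ℤ → ℤ} (hf : StrictMono f) {a b : ℤ} (h : a ≤ b) :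
    b - a ≤ f b - f a := by
  induction b, h using Int.leInduction with
  | base => simp
  | succ b hb ih => have := hf (show b < b + 1 by omega); omega

/-- An interval of `p ≥ 1` cells of the finer grid touches at most `p` cells of the coarser one. -/
theorem sub_le_of_knot_lt (h : range X.knot ⊆ range Y.knot) {a b k : ℤ} {p : ℕ} (hp : 1 ≤ p)
    (h1 : Y.knot k < X.knot (a + 1)) (h2 : X.knot (b - 1) < Y.knot (k + p)) : b - a ≤ p := by
  obtain ⟨f, hf, hmono⟩ := exists_strictMono_index h
  rw [← hf, Y.knot_lt_iff] at h1 h2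
  by_cases hab : a + 1 ≤ b - 1
  · have := sub_le_sub_of_strictMono hmono hab
    omega
  · omega

/-- No node of the coarser sequence lies strictly between consecutive nodes of the finer one. Hence
moving by one fine cell does not leave the coarse cells touched. -/
theorem knot_le_of_knot_lt_succ (h : range X.knot ⊆ range Y.knot) {a k : ℤ}
    (h1 : X.knot a < Y.knot (k + 1)) : X.knot a ≤ Y.knot k := by
  obtain ⟨f, hf, -⟩ := exists_strictMono_index h
  rw [← hf, Y.knot_lt_iff] at h1
  rw [← hf, Y.knot_le_iff]
  omega

theorem knot_succ_le_of_knot_lt (h : range X.knot ⊆ range Y.knot) {b k : ℤ}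
    (h1 : Y.knot k < X.knot b) : Y.knot (k + 1) ≤ X.knot b := by
  obtain ⟨f, hf, -⟩ := exists_strictMono_index h
  rw [← hf, Y.knot_lt_iff] at h1
  rw [← hf, Y.knot_le_iff]
  omega

end KnotSeq

/-! ### Cells, blocks and regions of a grid. -/

namespace Grid

variable {G F : Grid}

/-- The interior of a cell. -/
def openCell (G : Grid) (p : ℤ × ℤ) : Set (ℝ × ℝ) :=
  Ioo (G.xs.knot p.1) (G.xs.knot (p.1 + 1)) ×ˢ Ioo (G.ys.knot p.2) (G.ys.knot (p.2 + 1))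

theorem isOpen_openCell (p : ℤ × ℤ) : IsOpen (G.openCell p) := isOpen_Ioo.prod isOpen_Ioo

theorem closure_openCell (p : ℤ × ℤ) : closure (G.openCell p) = G.cell p := by
  rw [openCell, closure_prod_eq, closure_Ioo, closure_Ioo, cell]
  · exact (G.ys.strictMono (by omega)).ne
  · exact (G.xs.strictMono (by omega)).ne

theorem openCell_subset_cell (p : ℤ × ℤ) : G.openCell p ⊆ G.cell p :=
  (subset_closure).trans (closure_openCell p).le

theorem openCell_nonempty (p : ℤ × ℤ) : (G.openCell p).Nonempty :=
  (nonempty_Ioo.2 (G.xs.strictMono (by omega))).prod (nonempty_Ioo.2 (G.ys.strictMono (by omega)))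

theorem eq_of_mem_openCell_of_mem_cell {p p' : ℤ × ℤ} {q : ℝ × ℝ} (h : q ∈ G.openCell p)
    (h' : q ∈ G.cell p') : p' = p := by
  have a1 := G.xs.knot_lt_iff.1 (h'.1.1.trans_lt h.1.2)
  have a2 := G.xs.knot_lt_iff.1 (h.1.1.trans_le h'.1.2)
  have a3 := G.ys.knot_lt_iff.1 (h'.2.1.trans_lt h.2.2)
  have a4 := G.ys.knot_lt_iff.1 (h.2.1.trans_le h'.2.2)
  ext <;> omega

theorem mem_of_mem_openCell {S : Set (ℤ × ℤ)} {p : ℤ × ℤ} {q : ℝ × ℝ} (h : q ∈ G.openCell p)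
    (h' : q ∈ G.region S) : p ∈ S := by
  simp only [region, mem_iUnion] at h'
  obtain ⟨p', hp', hq⟩ := h'
  exact eq_of_mem_openCell_of_mem_cell h hq ▸ hp'

theorem cell_subset_region {S : Set (ℤ × ℤ)} {p : ℤ × ℤ} (h : p ∈ S) : G.cell p ⊆ G.region S :=
  subset_biUnion_of_mem h

theorem isClosed_region {S : Set (ℤ × ℤ)} (hS : S.Finite) : IsClosed (G.region S) :=
  hS.isClosed_biUnion fun _ _ => isClosed_Icc.prod isClosed_Icc

theorem isCompact_region {S : Set (ℤ × ℤ)} (hS : S.Finite) : IsCompact (G.region S) :=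
  hS.isCompact_biUnion fun _ _ => isCompact_Icc.prod isCompact_Icc

theorem openCell_subset_interior_region {S : Set (ℤ × ℤ)} {p : ℤ × ℤ} (h : p ∈ S) :
    G.openCell p ⊆ interior (G.region S) :=
  interior_maximal ((openCell_subset_cell p).trans (cell_subset_region h)) (isOpen_openCell p)

theorem region_subset_closure_interior (S : Set (ℤ × ℤ)) :
    G.region S ⊆ closure (interior (G.region S)) := by
  refine iUnion₂_subset fun p hp => ?_
  rw [← closure_openCell]
  exact closure_mono (openCell_subset_interior_region hp)

/-- The closed rectangle formed by the cells with indices in `[a, b) × [c, d)`. -/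
def block (G : Grid) (a b c d : ℤ) : Set (ℝ × ℝ) :=
  Icc (G.xs.knot a) (G.xs.knot b) ×ˢ Icc (G.ys.knot c) (G.ys.knot d)

theorem _root_.KnotSeq.exists_cell (X : KnotSeq) {a b : ℤ} (hab : a < b) {x : ℝ}
    (hx : x ∈ Icc (X.knot a) (X.knot b)) :
    ∃ i, a ≤ i ∧ i < b ∧ x ∈ Icc (X.knot i) (X.knot (i + 1)) := by
  rcases hx.2.lt_or_eq with h | h
  · obtain ⟨i, h1, h2⟩ := X.exists_knot_le_lt x
    have := X.knot_lt_iff.1 (hx.1.trans_lt h2)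
    exact ⟨i, by omega, X.knot_lt_iff.1 (h1.trans_lt h), h1, h2.le⟩
  · exact ⟨b - 1, by omega, by omega, by rw [h]; exact X.strictMono.monotone (by omega),
      by simpa using hx.2⟩

theorem block_subset_region {S : Set (ℤ × ℤ)} {a b c d : ℤ} (hab : a < b) (hcd : c < d)
    (h : AvoidsBlock Sᶜ a b c d) : G.block a b c d ⊆ G.region S := by
  rintro ⟨x, y⟩ ⟨hx, hy⟩
  obtain ⟨i, h1, h2, h3⟩ := G.xs.exists_cell hab hx
  obtain ⟨j, h4, h5, h6⟩ := G.ys.exists_cell hcd hy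
  exact cell_subset_region (not_not.1 (h i j h1 h2 h4 h5)) ⟨h3, h6⟩

theorem region_univ : G.region univ = univ := by
  refine eq_univ_of_forall fun q => ?_
  obtain ⟨i, h1, h2⟩ := G.xs.exists_knot_le_lt q.1
  obtain ⟨j, h3, h4⟩ := G.ys.exists_knot_le_lt q.2
  exact cell_subset_region (mem_univ (i, j)) ⟨⟨h1, h2.le⟩, h3, h4.le⟩

/-- If an open rectangle lies in a union of cells, then so do all cells which it meets. -/
theorem avoidsBlock_compl_of_subset {S : Set (ℤ × ℤ)} {u v u' v' : ℝ} (huv : u < v)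
    (huv' : u' < v') (h : Ioo u v ×ˢ Ioo u' v' ⊆ G.region S) {a b c d : ℤ}
    (ha : u < G.xs.knot (a + 1)) (hb : G.xs.knot (b - 1) < v)
    (hc : u' < G.ys.knot (c + 1)) (hd : G.ys.knot (d - 1) < v') : AvoidsBlock Sᶜ a b c d := by
  intro i j h1 h2 h3 h4 hij
  have key : ∀ (X : KnotSeq) (u v : ℝ) (a b i : ℤ), u < v → u < X.knot (a + 1) →
      X.knot (b - 1) < v → a ≤ i → i < b →
      ∃ x, x ∈ Ioo (X.knot i) (X.knot (i + 1)) ∧ x ∈ Ioo u v := fun X u v a b i huv ha hb h1 h2 => by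
    have e1 : X.knot (a + 1) ≤ X.knot (i + 1) := X.strictMono.monotone (by omega)
    have e2 : X.knot i ≤ X.knot (b - 1) := X.strictMono.monotone (by omega)
    have e3 : X.knot i < X.knot (i + 1) := X.strictMono (by omega)
    obtain ⟨x, hx1, hx2⟩ := exists_between
      (show max (X.knot i) u < min (X.knot (i + 1)) v from
        max_lt (lt_min e3 (by linarith)) (lt_min (by linarith) huv))
    rw [max_lt_iff] at hx1
    rw [lt_min_iff] at hx2
    exact ⟨x, ⟨hx1.1, hx2.1⟩, hx1.2, hx2.2⟩
  obtain ⟨x, hx1, hx2⟩ := key G.xs u v a b i huv ha hb h1 h2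
  obtain ⟨y, hy1, hy2⟩ := key G.ys u' v' c d j huv' hc hd h3 h4
  exact hij (mem_of_mem_openCell (p := (i, j)) (q := (x, y)) ⟨hx1, hy1⟩ (h ⟨hx2, hy2⟩))

/-- Every block of at most `m × (n + 1)` cells in `S` can be extended within `S` by a column, and
every block of at most `(m + 1) × n` cells can be extended by a row. -/
def Extendable (S : Set (ℤ × ℤ)) (m n : ℕ) : Prop :=
  (∀ a b c d : ℤ, a < b → b - a ≤ m → c < d → d - c ≤ n + 1 → ExtendsH Sᶜ a b c d) ∧
  (∀ a b c d : ℤ, a < b → b - a ≤ m + 1 → c < d → d - c ≤ n → ExtendsV Sᶜ a b c d)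

/-- Serves level 0, where the support of a parent is subject to no restriction from outside. -/
theorem extendable_univ (m n : ℕ) : Extendable univ m n :=
  ⟨fun _ _ _ _ _ _ _ _ _ => Or.inl fun _ _ _ _ _ _ => by simp,
    fun _ _ _ _ _ _ _ _ _ => Or.inl fun _ _ _ _ _ _ => by simp⟩

/-- A block that avoids the complement of `int Ω` in a surrounding rectangle and contains a cell
of `Ω` is contained in `Ω`. -/
theorem avoidsBlock_compl_of_avoidsBlock {S S' B : Set (ℤ × ℤ)} (hB : B.Finite)
    (hsub : G.region S ⊆ interior (G.region B))
    (hS' : G.region B \ interior (G.region S) = G.region S') {a b c d i j : ℤ}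
    (hij : (i, j) ∈ S) (hi : a ≤ i) (hi' : i < b) (hj : c ≤ j) (hj' : j < d)
    (h : AvoidsBlock S' a b c d) : AvoidsBlock Sᶜ a b c d := by
  have lx : G.xs.knot a < G.xs.knot b := G.xs.strictMono (by omega)
  have ly : G.ys.knot c < G.ys.knot d := G.ys.strictMono (by omega)
  set R := Ioo (G.xs.knot a) (G.xs.knot b) ×ˢ Ioo (G.ys.knot c) (G.ys.knot d) with hR
  have hRS' : ∀ q ∈ R, q ∉ G.region S' := by
    rintro q ⟨hq1, hq2⟩ hq
    simp only [region, mem_iUnion] at hq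
    obtain ⟨p, hp, hq3, hq4⟩ := hq
    have a1 := G.xs.knot_lt_iff.1 (hq1.1.trans_le hq3.2)
    have a2 := G.xs.knot_lt_iff.1 (hq3.1.trans_lt hq1.2)
    have a3 := G.ys.knot_lt_iff.1 (hq2.1.trans_le hq4.2)
    have a4 := G.ys.knot_lt_iff.1 (hq4.1.trans_lt hq2.2)
    exact h p.1 p.2 (by omega) (by omega) (by omega) (by omega) hp
  have hconn : IsPreconnected R := isPreconnected_Ioo.prod isPreconnected_Ioo
  have hint : R ⊆ interior (G.region S) := by
    -- Since `R` misses `S'`, it is covered by the interior of Ω and the complement of the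
    -- surrounding rectangle. These are disjoint open sets, and the cell `(i, j)` puts the connected
    -- set `R` into the first.
    refine hconn.subset_left_of_subset_union isOpen_interior
      (isClosed_region (G := G) hB).isOpen_compl ?_ ?_ ?_
    · rw [disjoint_compl_right_iff_subset]
      exact interior_subset.trans (hsub.trans interior_subset)
    · intro q hq
      by_contra hcon
      rw [mem_union, not_or, mem_compl_iff, not_not] at hcon
      exact hRS' q hq (hS' ▸ ⟨hcon.2, hcon.1⟩)
    · obtain ⟨q, hq⟩ := G.openCell_nonempty (i, j)
      refine ⟨q, ⟨?_, ?_⟩, openCell_subset_interior_region hij hq⟩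
      · exact ⟨lt_of_le_of_lt (G.xs.knot_le_iff.2 hi) hq.1.1,
          lt_of_lt_of_le hq.1.2 (G.xs.knot_le_iff.2 hi')⟩
      · exact ⟨lt_of_le_of_lt (G.ys.knot_le_iff.2 hj) hq.2.1,
          lt_of_lt_of_le hq.2.2 (G.ys.knot_le_iff.2 hj')⟩
  exact avoidsBlock_compl_of_subset lx ly (hint.trans interior_subset)
    (G.xs.strictMono (by omega)) (G.xs.strictMono (by omega))
    (G.ys.strictMono (by omega)) (G.ys.strictMono (by omega))

/-- The offset condition extends the block away from the complement inside the surrounding rectangle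
only. The extension cannot leave that rectangle either, because it is connected and still contains a
cell of Ω. -/
theorem ClassATilde.exists_extendable {m n : ℕ} {Ω : Set (ℝ × ℝ)} (h : G.ClassATilde m n Ω) :
    ∃ S : Set (ℤ × ℤ), Ω = G.region S ∧ Extendable S m n := by
  obtain ⟨⟨S, rfl, -⟩, a₀, b₀, c₀, d₀, hsub, S', hS', hoff⟩ := h
  have hB : (Icc a₀ b₀ ×ˢ Icc c₀ d₀ : Set (ℤ × ℤ)).Finite := (finite_Icc _ _).prod (finite_Icc _ _)
  have key : ∀ a b c d, AvoidsBlock Sᶜ a b c d → AvoidsBlock S' a b c d := by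
    intro a b c d hav i j h1 h2 h3 h4 hij
    have hmem : (i, j) ∈ S := not_not.1 (hav i j h1 h2 h3 h4)
    obtain ⟨q, hq⟩ := G.openCell_nonempty (i, j)
    have : q ∈ G.region S' := cell_subset_region hij (openCell_subset_cell _ hq)
    rw [← hS'] at this
    exact this.2 (openCell_subset_interior_region hmem hq)
  refine ⟨S, rfl, fun a b c d hab hm hcd hn hav => ?_, fun a b c d hab hm hcd hn hav => ?_⟩
  · have hmem : (a, c) ∈ S := not_not.1 (hav a c le_rfl hab le_rfl hcd)
    refine (hoff.extendsH hab hm hcd hn (key _ _ _ _ hav)).imp ?_ ?_ <;> intro g <;>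
      exact avoidsBlock_compl_of_avoidsBlock hB hsub hS' hmem (by omega) (by omega)
        (by omega) (by omega) g
  · have hmem : (a, c) ∈ S := not_not.1 (hav a c le_rfl hab le_rfl hcd)
    refine (hoff.extendsV hab hm hcd hn (key _ _ _ _ hav)).imp ?_ ?_ <;> intro g <;>
      exact avoidsBlock_compl_of_avoidsBlock hB hsub hS' hmem (by omega) (by omega)
        (by omega) (by omega) g

/-! ### Tensor products -/

/-- The tensor-product B-spline with the indices `i`, `j`. -/
noncomputable def tensor (G : Grid) (m n : ℕ) (i j : ℤ) : ℝ × ℝ → ℝ :=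
  fun q => G.xs.bspline m i q.1 * G.ys.bspline n j q.2

theorem tensor_mem (G : Grid) (m n : ℕ) (i j : ℤ) : G.tensor m n i j ∈ G.tensorBSplines m n :=
  ⟨i, j, rfl⟩

section

variable {m n : ℕ} (hm : 1 ≤ m) (hn : 1 ≤ n)
include hm hn

theorem support_tensor (i j : ℤ) : Function.support (G.tensor m n i j) =
    Ioo (G.xs.knot i) (G.xs.knot (i + m + 1)) ×ˢ Ioo (G.ys.knot j) (G.ys.knot (j + n + 1)) := by
  rw [← G.xs.support_bspline hm, ← G.ys.support_bspline hn]
  ext q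
  simp [tensor]

theorem tsupport_tensor (i j : ℤ) :
    tsupport (G.tensor m n i j) = G.block i (i + m + 1) j (j + n + 1) := by
  rw [tsupport, support_tensor hm hn, closure_prod_eq, closure_Ioo, closure_Ioo, block]
  · exact (G.ys.strictMono (by omega)).ne
  · exact (G.xs.strictMono (by omega)).ne

end

/-- The cone spanned by the tensor-product B-splines over `G` with support in `R`. -/
def cone (G : Grid) (m n : ℕ) (R : Set (ℝ × ℝ)) : Submodule ℝ≥0 (ℝ × ℝ → ℝ) :=
  Submodule.span ℝ≥0 {τ | τ ∈ G.tensorBSplines m n ∧ tsupport τ ⊆ R}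

theorem mul_mem_cone {m n : ℕ} (hm : 1 ≤ m) (hn : 1 ≤ n) {u v c d : ℝ} {f g : ℝ → ℝ}
    (hf : f ∈ G.xs.cone m u v) (hg : g ∈ G.ys.cone n c d) :
    (fun q : ℝ × ℝ => f q.1 * g q.2) ∈ G.cone m n (Icc u v ×ˢ Icc c d) := by
  induction hf using Submodule.span_induction with
  | mem f hf =>
    obtain ⟨i, h1, h2, rfl⟩ := hf
    induction hg using Submodule.span_induction with
    | mem g hg =>
      obtain ⟨j, h3, h4, rfl⟩ := hg
      refine Submodule.subset_span ⟨G.tensor_mem m n i j, ?_⟩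
      have := tsupport_tensor (G := G) hm hn i j
      exact this.le.trans (prod_mono (Icc_subset_Icc h1 h2) (Icc_subset_Icc h3 h4))
    | zero =>
      convert Submodule.zero_mem (G.cone m n (Icc u v ×ˢ Icc c d)) using 1
      ext q; simp
    | add g g' _ _ h h' =>
      convert Submodule.add_mem _ h h' using 1
      ext q; simp [mul_add]
    | smul r g _ h =>
      convert Submodule.smul_mem _ r h using 1
      ext q; simp [NNReal.smul_def]; ring
  | zero =>
    convert Submodule.zero_mem (G.cone m n (Icc u v ×ˢ Icc c d)) using 1
    ext q; simp
  | add f f' _ _ h h' =>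
    convert Submodule.add_mem _ h h' using 1
    ext q; simp [add_mul]
  | smul r f _ h =>
    convert Submodule.smul_mem _ r h using 1
    ext q; simp [NNReal.smul_def]; ring

theorem mem_cone_of_sub {m n : ℕ} (hm : 1 ≤ m) (hn : 1 ≤ n) (h : G.Sub F) {τ : ℝ × ℝ → ℝ}
    (hτ : τ ∈ G.tensorBSplines m n) : τ ∈ F.cone m n (tsupport τ) := by
  obtain ⟨i, j, rfl⟩ := hτ
  change G.tensor m n i j ∈ F.cone m n (tsupport (G.tensor m n i j))
  rw [tsupport_tensor hm hn]
  exact mul_mem_cone hm hn (KnotSeq.bspline_mem_cone_of_range_subset h.1 m i)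
    (KnotSeq.bspline_mem_cone_of_range_subset h.2 n j)

end Grid

/-! ### Parents of tensor-product B-splines inside a domain. -/

namespace Grid

variable {G F : Grid} {m n : ℕ}

theorem block_subset_block {a b c d a' b' c' d' : ℤ} (ha : G.xs.knot a ≤ F.xs.knot a')
    (hb : F.xs.knot b' ≤ G.xs.knot b) (hc : G.ys.knot c ≤ F.ys.knot c')
    (hd : F.ys.knot d' ≤ G.ys.knot d) : F.block a' b' c' d' ⊆ G.block a b c d :=
  prod_mono (Icc_subset_Icc ha hb) (Icc_subset_Icc hc hd)

/-- The support is replaced by the smallest block of cells of `G` containing it. A parent either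
stays in that block or needs one more column on a prescribed side, and of the two candidates one
fits into the extension provided by `Extendable`. -/
theorem exists_parent_vertical (hm : 1 ≤ m) (hGF : G.Sub F) {S : Set (ℤ × ℤ)}
    (hS : Extendable S m n) (t : ℝ) {k l : ℤ}
    (hsub : (F.insertLine (.vertical t)).block k (k + m + 1) l (l + n + 1) ⊆ G.region S) :
    ∃ r, KnotSeq.IsParent F.xs (F.xs.insertKnot t) m r k ∧
      (F.insertLine (.vertical t)).block k (k + m + 1) l (l + n + 1) ⊆
        F.block r (r + m + 1) l (l + n + 1) ∧
      F.block r (r + m + 1) l (l + n + 1) ⊆ G.region S := by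
  set Y := F.xs.insertKnot t with hY
  have huv : Y.knot k < Y.knot (k + m + 1) := Y.strictMono (by omega)
  have hcd : F.ys.knot l < F.ys.knot (l + n + 1) := F.ys.strictMono (by omega)
  obtain ⟨a, ha, ha'⟩ := G.xs.exists_knot_le_lt (Y.knot k)
  obtain ⟨b, hb', hb⟩ := G.xs.exists_knot_lt_le (Y.knot (k + m + 1))
  obtain ⟨c, hc, hc'⟩ := G.ys.exists_knot_le_lt (F.ys.knot l)
  obtain ⟨d, hd', hd⟩ := G.ys.exists_knot_lt_le (F.ys.knot (l + n + 1))
  have hav : AvoidsBlock Sᶜ a b c d := avoidsBlock_compl_of_subset huv hcd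
    ((Set.prod_mono Ioo_subset_Icc_self Ioo_subset_Icc_self).trans hsub) ha' hb' hc' hd'
  have hab : a < b := G.xs.knot_lt_iff.1 (ha.trans_lt (huv.trans_le hb))
  have hcd' : c < d := G.ys.knot_lt_iff.1 (hc.trans_lt (hcd.trans_le hd))
  rcases F.xs.exists_isParent t m k with ⟨r, hr, h1, h2, h3, h4⟩ | ⟨h1, h2, hl, hr⟩
  · refine ⟨r, hr, block_subset_block h1 h4 le_rfl le_rfl, ?_⟩
    refine (block_subset_block ?_ ?_ hc hd).trans (block_subset_region hab hcd' hav)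
    · exact KnotSeq.knot_le_of_knot_lt_succ hGF.1 (ha.trans_lt h2)
    · exact KnotSeq.knot_succ_le_of_knot_lt hGF.1 (h3.trans_le hb)
  · rw [← hY] at h1 h2
    rw [h1] at ha ha'
    rw [h2] at hb hb'
    have e1 : (k - 1 + m + 1 : ℤ) = k + m := by ring
    have l1 : F.xs.knot (k - 1) ≤ F.xs.knot k := F.xs.strictMono.monotone (by omega)
    have l2 : F.xs.knot (k + m) ≤ F.xs.knot (k + m + 1) := F.xs.strictMono.monotone (by omega)
    have hdc : d - c ≤ n + 1 := by
      have := KnotSeq.sub_le_of_knot_lt (p := n + 1) hGF.2 (by omega) hc'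
        (by push_cast; rwa [← add_assoc])
      push_cast at this; exact this
    -- With two parents the ends of the support are the knots `k` and `k + m` of `F`. It spans `m`
    -- cells of `F` and hence at most `m` columns of `G`, one fewer than a general support could.
    rcases hS.1 a b c d hab (KnotSeq.sub_le_of_knot_lt hGF.1 hm ha' hb') hcd' hdc hav with g | g
    · refine ⟨k - 1, hl, ?_, ?_⟩
      · exact block_subset_block (h1 ▸ l1) (by rw [e1]; exact h2.le) le_rfl le_rfl
      · refine (block_subset_block ?_ ?_ hc hd).trans (block_subset_region (by omega) hcd' g)
        · refine KnotSeq.knot_le_of_knot_lt_succ hGF.1 ?_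
          rw [sub_add_cancel]; exact (G.xs.strictMono (by omega)).trans_le ha
        · rwa [e1]
    · refine ⟨k, hr, ?_, ?_⟩
      · exact block_subset_block h1.ge (h2.trans_le l2) le_rfl le_rfl
      · refine (block_subset_block ha ?_ hc hd).trans (block_subset_region (by omega) hcd' g)
        exact KnotSeq.knot_succ_le_of_knot_lt hGF.1 (hb.trans_lt (G.xs.strictMono (by omega)))

theorem exists_parent_horizontal (hn : 1 ≤ n) (hGF : G.Sub F) {S : Set (ℤ × ℤ)}
    (hS : Extendable S m n) (t : ℝ) {k l : ℤ}
    (hsub : (F.insertLine (.horizontal t)).block k (k + m + 1) l (l + n + 1) ⊆ G.region S) :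
    ∃ r, KnotSeq.IsParent F.ys (F.ys.insertKnot t) n r l ∧
      (F.insertLine (.horizontal t)).block k (k + m + 1) l (l + n + 1) ⊆
        F.block k (k + m + 1) r (r + n + 1) ∧
      F.block k (k + m + 1) r (r + n + 1) ⊆ G.region S := by
  set Y := F.ys.insertKnot t with hY
  have huv : F.xs.knot k < F.xs.knot (k + m + 1) := F.xs.strictMono (by omega)
  have hcd : Y.knot l < Y.knot (l + n + 1) := Y.strictMono (by omega)
  obtain ⟨a, ha, ha'⟩ := G.xs.exists_knot_le_lt (F.xs.knot k)
  obtain ⟨b, hb', hb⟩ := G.xs.exists_knot_lt_le (F.xs.knot (k + m + 1))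
  obtain ⟨c, hc, hc'⟩ := G.ys.exists_knot_le_lt (Y.knot l)
  obtain ⟨d, hd', hd⟩ := G.ys.exists_knot_lt_le (Y.knot (l + n + 1))
  have hav : AvoidsBlock Sᶜ a b c d := avoidsBlock_compl_of_subset huv hcd
    ((Set.prod_mono Ioo_subset_Icc_self Ioo_subset_Icc_self).trans hsub) ha' hb' hc' hd'
  have hab : a < b := G.xs.knot_lt_iff.1 (ha.trans_lt (huv.trans_le hb))
  have hcd' : c < d := G.ys.knot_lt_iff.1 (hc.trans_lt (hcd.trans_le hd))
  rcases F.ys.exists_isParent t n l with ⟨r, hr, h1, h2, h3, h4⟩ | ⟨h1, h2, hl, hr⟩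
  · refine ⟨r, hr, block_subset_block le_rfl le_rfl h1 h4, ?_⟩
    refine (block_subset_block ha hb ?_ ?_).trans (block_subset_region hab hcd' hav)
    · exact KnotSeq.knot_le_of_knot_lt_succ hGF.2 (hc.trans_lt h2)
    · exact KnotSeq.knot_succ_le_of_knot_lt hGF.2 (h3.trans_le hd)
  · rw [← hY] at h1 h2
    rw [h1] at hc hc'
    rw [h2] at hd hd'
    have e1 : (l - 1 + n + 1 : ℤ) = l + n := by ring
    have l1 : F.ys.knot (l - 1) ≤ F.ys.knot l := F.ys.strictMono.monotone (by omega)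
    have l2 : F.ys.knot (l + n) ≤ F.ys.knot (l + n + 1) := F.ys.strictMono.monotone (by omega)
    have hba : b - a ≤ m + 1 := by
      have := KnotSeq.sub_le_of_knot_lt (p := m + 1) hGF.1 (by omega) ha'
        (by push_cast; rwa [← add_assoc])
      push_cast at this; exact this
    rcases hS.2 a b c d hab hba hcd' (KnotSeq.sub_le_of_knot_lt hGF.2 hn hc' hd') hav with g | g
    · refine ⟨l - 1, hl, ?_, ?_⟩
      · exact block_subset_block le_rfl le_rfl (h1 ▸ l1) (by rw [e1]; exact h2.le)
      · refine (block_subset_block ha hb ?_ ?_).trans (block_subset_region hab (by omega) g)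
        · refine KnotSeq.knot_le_of_knot_lt_succ hGF.2 ?_
          rw [sub_add_cancel]; exact (G.ys.strictMono (by omega)).trans_le hc
        · rwa [e1]
    · refine ⟨l, hr, ?_, ?_⟩
      · exact block_subset_block le_rfl le_rfl h1.ge (h2.trans_le l2)
      · refine (block_subset_block ha hb hc ?_).trans (block_subset_region hab (by omega) g)
        exact KnotSeq.knot_succ_le_of_knot_lt hGF.2 (hd.trans_lt (G.ys.strictMono (by omega)))

/-- Every tensor-product B-spline over `F ∪ {l}` with support in a suitable union `Ω` of cells of
a coarser grid occurs with a positive coefficient in a tensor-product B-spline over `F` with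
support in `Ω`. -/
theorem exists_parent (hm : 1 ≤ m) (hn : 1 ≤ n) (hGF : G.Sub F) {S : Set (ℤ × ℤ)}
    (hS : Extendable S m n) (l : AxisLine) {τ : ℝ × ℝ → ℝ}
    (hτ : τ ∈ (F.insertLine l).tensorBSplines m n) (hsub : tsupport τ ⊆ G.region S) :
    ∃ σ ∈ F.tensorBSplines m n, tsupport τ ⊆ tsupport σ ∧ tsupport σ ⊆ G.region S ∧
      ∃ α : ℝ≥0, 0 < α ∧ ∃ g ∈ (F.insertLine l).cone m n (tsupport σ), σ = α • τ + g := by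
  obtain ⟨i, j, hτ⟩ := hτ
  replace hτ : τ = (F.insertLine l).tensor m n i j := hτ
  subst hτ
  rw [tsupport_tensor hm hn] at hsub ⊢
  rcases l with t | t
  · obtain ⟨r, ⟨α, hα, g, hg, hrg⟩, h1, h2⟩ := exists_parent_vertical hm hGF hS t hsub
    refine ⟨F.tensor m n r j, F.tensor_mem m n r j, ?_⟩
    rw [tsupport_tensor hm hn]
    refine ⟨h1, h2, α, hα, _, mul_mem_cone (G := F.insertLine (.vertical t)) hm hn hg
      (KnotSeq.bspline_mem_cone (X := F.ys) (j := j) le_rfl le_rfl), ?_⟩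
    ext q
    simp [tensor, hrg, insertLine, NNReal.smul_def]
    ring
  · obtain ⟨r, ⟨α, hα, g, hg, hrg⟩, h1, h2⟩ := exists_parent_horizontal hn hGF hS t hsub
    refine ⟨F.tensor m n i r, F.tensor_mem m n i r, ?_⟩
    rw [tsupport_tensor hm hn]
    refine ⟨h1, h2, α, hα, _, mul_mem_cone (G := F.insertLine (.horizontal t)) hm hn
      (KnotSeq.bspline_mem_cone (X := F.xs) (j := i) le_rfl le_rfl) hg, ?_⟩
    ext q
    simp [tensor, hrg, insertLine, NNReal.smul_def]
    ring

theorem finite_tensorBSplines_inter (hm : 1 ≤ m) (hn : 1 ≤ n) (G : Grid) {Ω : Set (ℝ × ℝ)}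
    (hΩ : Bornology.IsBounded Ω) :
    {τ | τ ∈ G.tensorBSplines m n ∧ (tsupport τ ∩ Ω).Nonempty}.Finite := by
  obtain ⟨M, hM⟩ := hΩ.subset_closedBall 0
  have key : ∀ (X : KnotSeq) (p : ℕ),
      {i | (Icc (X.knot i) (X.knot (i + p + 1)) ∩ Icc (-M) M).Nonempty}.Finite := fun X p => by
    obtain ⟨a, ha, -⟩ := X.exists_knot_le_lt (-M)
    obtain ⟨b, -, hb⟩ := X.exists_knot_le_lt M
    refine (finite_Icc (a - p - 1) (b + 1)).subset ?_
    rintro i ⟨x, hx1, hx2⟩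
    have h1 := X.knot_lt_iff.1 (hx1.1.trans_lt (hx2.2.trans_lt hb))
    have h2 := X.knot_le_iff.1 ((ha.trans hx2.1).trans hx1.2)
    exact ⟨by omega, h1.le⟩
  refine (((key G.xs m).prod (key G.ys n)).image fun p => G.tensor m n p.1 p.2).subset ?_
  rintro τ ⟨⟨i, j, hτ⟩, q, hq, hqΩ⟩
  replace hτ : τ = G.tensor m n i j := hτ
  subst hτ
  rw [tsupport_tensor hm hn] at hq
  have hq0 := hM hqΩ
  rw [mem_closedBall_zero_iff, Prod.norm_def, max_le_iff] at hq0
  exact ⟨(i, j), ⟨⟨q.1, hq.1, abs_le.1 hq0.1⟩, ⟨q.2, hq.2, abs_le.1 hq0.2⟩⟩, rfl⟩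

theorem sub_insertLine (G : Grid) (l : AxisLine) : G.Sub (G.insertLine l) := by
  rcases l with t | t
  · exact ⟨by simp [insertLine, KnotSeq.range_insertKnot], Subset.rfl⟩
  · exact ⟨Subset.rfl, by simp [insertLine, KnotSeq.range_insertKnot]⟩

theorem Sub.trans {G₁ G₂ G₃ : Grid} (h : G₁.Sub G₂) (h' : G₂.Sub G₃) : G₁.Sub G₃ :=
  ⟨h.1.trans h'.1, h.2.trans h'.2⟩

theorem Sub.insertLine (h : G.Sub F) (l : AxisLine) : (G.insertLine l).Sub (F.insertLine l) := by
  rcases l with t | t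
  · refine ⟨?_, h.2⟩
    simp only [Grid.insertLine, KnotSeq.range_insertKnot]
    exact insert_subset_insert h.1
  · refine ⟨h.1, ?_⟩
    simp only [Grid.insertLine, KnotSeq.range_insertKnot]
    exact insert_subset_insert h.2

end Grid

/-! ### Non-negative combinations and positive weights. -/

/-- The functions that agree on `Ω` with a non-negative combination of the functions in `s`. -/
def nonnegCombinations (s : Finset (ℝ × ℝ → ℝ)) (Ω : Set (ℝ × ℝ)) :
    Submodule ℝ≥0 (ℝ × ℝ → ℝ) where
  carrier := {f | ∃ c : (ℝ × ℝ → ℝ) → ℝ, (∀ τ, 0 ≤ c τ) ∧ ∀ q ∈ Ω, f q = ∑ τ ∈ s, c τ * τ q}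
  zero_mem' := ⟨0, fun _ => le_rfl, fun q _ => by simp⟩
  add_mem' := by
    rintro f g ⟨c, hc, h⟩ ⟨c', hc', h'⟩
    refine ⟨c + c', fun τ => add_nonneg (hc τ) (hc' τ), fun q hq => ?_⟩
    simp [h q hq, h' q hq, add_mul, Finset.sum_add_distrib]
  smul_mem' := by
    rintro r f ⟨c, hc, h⟩
    refine ⟨fun τ => r * c τ, fun τ => mul_nonneg r.2 (hc τ), fun q hq => ?_⟩
    simp [NNReal.smul_def, h q hq, Finset.mul_sum, mul_assoc]

section

variable {s : Finset (ℝ × ℝ → ℝ)} {Ω : Set (ℝ × ℝ)}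

theorem mem_nonnegCombinations_of_mem {τ : ℝ × ℝ → ℝ} (h : τ ∈ s) :
    τ ∈ nonnegCombinations s Ω := by
  classical
  refine ⟨fun σ => if σ = τ then 1 else 0, fun σ => ?_, fun q _ => ?_⟩
  · dsimp only; split_ifs <;> norm_num
  · simp [h]

theorem mem_nonnegCombinations_congr {f g : ℝ × ℝ → ℝ} (hg : g ∈ nonnegCombinations s Ω)
    (h : ∀ q ∈ Ω, f q = g q) : f ∈ nonnegCombinations s Ω := by
  obtain ⟨c, hc, hg⟩ := hg
  exact ⟨c, hc, fun q hq => (h q hq).trans (hg q hq)⟩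

/-- If each `τ ∈ s` can be split off with a positive coefficient from the constant `1` within the
cone of the non-negative combinations, then `1` is a positive combination. -/
theorem exists_positive_weights (h1 : (fun _ => 1) ∈ nonnegCombinations s Ω)
    (h : ∀ τ ∈ s, ∃ ε : ℝ, 0 < ε ∧ ∃ g ∈ nonnegCombinations s Ω, ∀ q ∈ Ω, 1 = ε * τ q + g q) :
    ∃ w : (ℝ × ℝ → ℝ) → ℝ, (∀ τ ∈ s, 0 < w τ) ∧ ∀ q ∈ Ω, ∑ τ ∈ s, w τ * τ q = 1 := by
  classical
  rcases s.eq_empty_or_nonempty with rfl | hne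
  · obtain ⟨c, -, hc⟩ := h1
    exact ⟨c, by simp, fun q hq => (hc q hq).symm⟩
  have h' : ∀ τ ∈ s, ∃ c : (ℝ × ℝ → ℝ) → ℝ, (∀ σ, 0 ≤ c σ) ∧ 0 < c τ ∧
      ∀ q ∈ Ω, 1 = ∑ σ ∈ s, c σ * σ q := by
    intro τ hτ
    obtain ⟨ε, hε, g, ⟨c, hc, hg⟩, h⟩ := h τ hτ
    refine ⟨fun σ => (if σ = τ then ε else 0) + c σ, fun σ => ?_, ?_, fun q hq => ?_⟩
    · exact add_nonneg (by split_ifs <;> linarith) (hc σ)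
    · simpa using add_pos_of_pos_of_nonneg hε (hc τ)
    · rw [h q hq, hg q hq]
      simp [add_mul, Finset.sum_add_distrib, hτ]
  choose! c hc hpos hsum using h'
  have hcard : (0 : ℝ) < s.card := by exact_mod_cast hne.card_pos
  -- The average of the representations of 1: the one belonging to `σ` contributes a positive weight
  -- at `σ`, the others non-negative ones.
  refine ⟨fun σ => (s.card : ℝ)⁻¹ * ∑ τ ∈ s, c τ σ, fun σ hσ => ?_, fun q hq => ?_⟩
  · exact mul_pos (inv_pos.2 hcard)
      (Finset.sum_pos' (fun τ hτ => hc τ hτ σ) ⟨σ, hσ, hpos σ hσ⟩)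
  · simp only [mul_assoc, ← Finset.mul_sum, Finset.sum_mul]
    rw [Finset.sum_comm, Finset.sum_congr rfl fun τ hτ => (hsum τ hτ q hq).symm]
    simp [hcard.ne']

end

/-! ### Hierarchical B-splines and persistence of positive partitions of unity. -/

namespace HierData

variable {N : ℕ} {H : HierData N} {m n : ℕ}

theorem tensorBSpline_isOpen_support (hm : 1 ≤ m) (hn : 1 ≤ n) {G : Grid} {τ : ℝ × ℝ → ℝ}
    (hτ : τ ∈ G.tensorBSplines m n) :
    IsOpen (Function.support τ) ∧ IsPreconnected (Function.support τ) := by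
  obtain ⟨i, j, hτ⟩ := hτ
  replace hτ : τ = G.tensor m n i j := hτ
  rw [hτ, Grid.support_tensor hm hn]
  exact ⟨isOpen_Ioo.prod isOpen_Ioo, isPreconnected_Ioo.prod isPreconnected_Ioo⟩

/-- The properties of the domains and grids of a hierarchical mesh that are kept by the insertion
of lines and make positive partitions of unity persist. -/
structure IsExtendable (H : HierData N) (m n : ℕ) : Prop where
  grid_nested : ∀ ℓ, ℓ + 1 < N → (H.grid ℓ).Sub (H.grid (ℓ + 1))
  dom_last : H.dom N = ∅
  isBounded_dom_zero : Bornology.IsBounded (H.dom 0)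
  dom_zero_subset : H.dom 0 ⊆ closure (interior (H.dom 0))
  isClosed_dom : ∀ ℓ < N, IsClosed (H.dom ℓ)
  dom_subset_interior : ∀ ℓ, 1 ≤ ℓ → ℓ < N → H.dom ℓ ⊆ interior (H.dom 0)
  exists_grid : ∀ ℓ, 1 ≤ ℓ → ℓ < N → ∃ (G : Grid) (S : Set (ℤ × ℤ)),
    G.Sub (H.grid ℓ) ∧ H.dom ℓ = G.region S ∧ Grid.Extendable S m n

/-- The grid `G` in `exists_grid` stays the same, and only the grid of level ℓ above it gets finer.
-/
theorem IsExtendable.refine (hH : H.IsExtendable m n) (j : ℕ) (l : AxisLine) :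
    (H.refine j l).IsExtendable m n where
  grid_nested ℓ hℓ := by
    have h := hH.grid_nested ℓ hℓ
    simp only [HierData.refine]
    split_ifs with h1 h2 h2
    · exact h.insertLine l
    · omega
    · exact h.trans (Grid.sub_insertLine _ l)
    · exact h
  dom_last := hH.dom_last
  isBounded_dom_zero := hH.isBounded_dom_zero
  dom_zero_subset := hH.dom_zero_subset
  isClosed_dom := hH.isClosed_dom
  dom_subset_interior := hH.dom_subset_interior
  exists_grid ℓ h1 h2 := by
    obtain ⟨G, S, hG, h⟩ := hH.exists_grid ℓ h1 h2
    refine ⟨G, S, ?_, h⟩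
    simp only [HierData.refine]
    split_ifs
    · exact hG.trans (Grid.sub_insertLine _ l)
    · exact hG

theorem tsupport_inter_nonempty_of_mem_levelBSplines {ℓ : ℕ} {τ : ℝ × ℝ → ℝ}
    (h : τ ∈ H.levelBSplines m n ℓ) : (tsupport τ ∩ H.dom 0).Nonempty :=
  h.2.2.mono (inter_subset_inter_right _ (interior_subset.trans sdiff_subset))

section

variable (hm : 1 ≤ m) (hn : 1 ≤ n) (hH : H.IsExtendable m n)
include hm hn hH

theorem finite_hierBSplines : (H.hierBSplines m n).Finite := by
  refine ((finite_lt_nat N).biUnion fun ℓ _ =>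
    (H.grid ℓ).finite_tensorBSplines_inter hm hn hH.isBounded_dom_zero).subset ?_
  rintro τ ⟨ℓ, hℓ, hτ⟩
  exact mem_biUnion (show ℓ ∈ {i | i < N} from hℓ)
    ⟨hτ.1, tsupport_inter_nonempty_of_mem_levelBSplines hτ⟩

/-- The set where the B-spline is nonzero is open; if it contained a point of Ω^0, it would meet the
interior, which is dense in Ω^0. -/
theorem eq_zero_of_tsupport_inter_interior {G : Grid} {τ : ℝ × ℝ → ℝ}
    (hτ : τ ∈ G.tensorBSplines m n) (h : tsupport τ ∩ interior (H.dom 0) = ∅) {q : ℝ × ℝ}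
    (hq : q ∈ H.dom 0) : τ q = 0 := by
  by_contra hne
  obtain ⟨q', h1, h2⟩ := mem_closure_iff.1 (hH.dom_zero_subset hq) _
    (tensorBSpline_isOpen_support hm hn hτ).1 hne
  have h3 : q' ∈ tsupport τ ∩ interior (H.dom 0) := ⟨subset_tsupport _ h1, h2⟩
  rw [h] at h3
  exact h3

/-- A B-spline of level `ℓ` whose support does not meet `int R^{ℓ-1}` is a non-negative
combination of hierarchical B-splines on `Ω^0`. -/
theorem mem_nonnegCombinations_of_tsupport {s : Finset (ℝ × ℝ → ℝ)}
    (hs : ∀ τ, τ ∈ s ↔ τ ∈ H.hierBSplines m n) {ℓ : ℕ} (hℓ : ℓ < N) {τ : ℝ × ℝ → ℝ}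
    (hτ : τ ∈ (H.grid ℓ).tensorBSplines m n)
    (hsupp : tsupport τ ∩ interior (H.dom 0 \ H.dom ℓ) = ∅) :
    τ ∈ nonnegCombinations s (H.dom 0) := by
  obtain ⟨k, hk⟩ : ∃ k, ℓ + 1 + k = N := ⟨N - (ℓ + 1), by omega⟩
  induction k generalizing ℓ τ with
  | zero =>
    by_cases hne : (tsupport τ ∩ interior (H.dom 0 \ H.dom (ℓ + 1))).Nonempty
    · exact mem_nonnegCombinations_of_mem ((hs τ).2 ⟨ℓ, hℓ, hτ, hsupp, hne⟩)
    · rw [show ℓ + 1 = N from hk, hH.dom_last, sdiff_empty, not_nonempty_iff_eq_empty] at hne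
      exact mem_nonnegCombinations_congr (Submodule.zero_mem _) fun q hq =>
        eq_zero_of_tsupport_inter_interior hm hn hH hτ hne hq
  | succ k ih =>
    by_cases hne : (tsupport τ ∩ interior (H.dom 0 \ H.dom (ℓ + 1))).Nonempty
    · exact mem_nonnegCombinations_of_mem ((hs τ).2 ⟨ℓ, hℓ, hτ, hsupp, hne⟩)
    · rw [not_nonempty_iff_eq_empty] at hne
      -- The B-spline is not selected at level ℓ because its support misses the interior of R^ℓ.
      -- This is the hypothesis at level ℓ + 1, and it passes to the smaller supports of its pieces.
      have hlt : ℓ + 1 < N := by omega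
      refine (Submodule.span_le.2 ?_) (Grid.mem_cone_of_sub hm hn (hH.grid_nested ℓ hlt) hτ)
      rintro σ ⟨h1, h2⟩
      exact ih hlt h1 (subset_eq_empty (inter_subset_inter_left _ h2) hne) (by omega)

/-- The support of a hierarchical B-spline of level `ℓ ≥ 1` lies in `Ω^ℓ`. -/
theorem tsupport_subset_dom {ℓ : ℕ} (hℓ : 1 ≤ ℓ) (hℓN : ℓ < N) {τ : ℝ × ℝ → ℝ}
    (h : τ ∈ H.levelBSplines m n ℓ) : tsupport τ ⊆ H.dom ℓ := by
  obtain ⟨hopen, hconn⟩ := tensorBSpline_isOpen_support hm hn h.1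
  refine closure_minimal (fun q hq => ?_) (hH.isClosed_dom ℓ hℓN)
  by_contra hcon
  obtain ⟨q₁, h1, h2⟩ := h.2.2
  obtain ⟨q₂, h3, h4⟩ := mem_closure_iff.1 h1 _ isOpen_interior h2
  -- The connected support is covered by the open sets int Ω^0 and the complement of Ω^ℓ, because
  -- Ω^ℓ lies in int Ω^0. If it met both, it would meet their intersection, which lies in int
  -- R^{ℓ-1}.
  obtain ⟨q₃, h5, h6, h7⟩ := hconn (interior (H.dom 0)) (H.dom ℓ)ᶜ isOpen_interior
    (hH.isClosed_dom ℓ hℓN).isOpen_compl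
    (fun q _ => by
      by_cases hq : q ∈ H.dom ℓ
      · exact Or.inl (hH.dom_subset_interior ℓ hℓ hℓN hq)
      · exact Or.inr hq)
    ⟨q₂, h4, interior_mono sdiff_subset h3⟩ ⟨q, hq, hcon⟩
  have h8 : q₃ ∈ interior (H.dom 0 \ H.dom ℓ) :=
    interior_maximal (sdiff_subset_sdiff_left interior_subset)
      (isOpen_interior.inter (hH.isClosed_dom ℓ hℓN).isOpen_compl) ⟨h6, h7⟩
  have h9 : q₃ ∈ tsupport τ ∩ interior (H.dom 0 \ H.dom ℓ) := ⟨subset_tsupport _ h5, h8⟩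
  rw [h.2.1] at h9
  exact h9

/-- Every hierarchical B-spline of the refined mesh occurs with a positive coefficient in one of
the original mesh. -/
theorem exists_parent_refine (j : ℕ) (l : AxisLine) {ℓ : ℕ} (hℓ : ℓ < N) {τ : ℝ × ℝ → ℝ}
    (hτ : τ ∈ (H.refine j l).levelBSplines m n ℓ) :
    ∃ σ ∈ H.levelBSplines m n ℓ, ∃ α : ℝ≥0, 0 < α ∧
      ∃ g ∈ ((H.refine j l).grid ℓ).cone m n (tsupport σ), σ = α • τ + g := by
  by_cases hj : j ≤ ℓ
  · have hgrid : (H.refine j l).grid ℓ = (H.grid ℓ).insertLine l := if_pos hj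
    rw [hgrid]
    have hτ1 := hτ.1
    rw [hgrid] at hτ1
    rcases Nat.eq_zero_or_pos ℓ with rfl | hpos
    · obtain ⟨σ, hσ, h1, -, h2⟩ := Grid.exists_parent hm hn (G := H.grid 0) (F := H.grid 0)
        ⟨Subset.rfl, Subset.rfl⟩ (Grid.extendable_univ m n) l hτ1
        (Grid.region_univ.symm ▸ subset_univ _)
      exact ⟨σ, ⟨hσ, by simp, hτ.2.2.mono (inter_subset_inter_left _ h1)⟩, h2⟩
    · obtain ⟨G, S, hG, hS, hext⟩ := hH.exists_grid ℓ hpos hℓ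
      have hsub := tsupport_subset_dom hm hn (hH.refine j l) hpos hℓ hτ
      obtain ⟨σ, hσ, h1, h3, h2⟩ := Grid.exists_parent hm hn hG hext l hτ1 (hS ▸ hsub)
      refine ⟨σ, ⟨hσ, ?_, hτ.2.2.mono (inter_subset_inter_left _ h1)⟩, h2⟩
      rw [← hS] at h3
      exact disjoint_iff_inter_eq_empty.1
        ((disjoint_sdiff_left.mono_left interior_subset).symm.mono_left h3)
  · have hgrid : (H.refine j l).grid ℓ = H.grid ℓ := if_neg hj
    refine ⟨τ, ⟨hgrid ▸ hτ.1, hτ.2⟩, 1, one_pos, 0, Submodule.zero_mem _, by simp⟩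

theorem HasWeightedPartition.refine (h : H.HasWeightedPartition m n) (j : ℕ) (l : AxisLine) :
    (H.refine j l).HasWeightedPartition m n := by
  obtain ⟨w, hw, hsum⟩ := h
  have hH' := hH.refine j l
  have hfin := finite_hierBSplines hm hn hH
  have hfin' := finite_hierBSplines hm hn hH'
  have hs' : ∀ τ, τ ∈ hfin'.toFinset ↔ τ ∈ (H.refine j l).hierBSplines m n :=
    fun τ => hfin'.mem_toFinset
  have hone : ∀ q ∈ H.dom 0, ∑ τ ∈ hfin.toFinset, w τ * τ q = 1 := fun q hq => by
    rw [← finsum_mem_eq_finite_toFinset_sum _ hfin]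
    exact hsum q hq
  have hcomb : ∀ τ ∈ hfin.toFinset, τ ∈ nonnegCombinations hfin'.toFinset (H.dom 0) := by
    intro τ hτ
    obtain ⟨ℓ, hℓ, hτ⟩ := hfin.mem_toFinset.1 hτ
    have hsub : (H.grid ℓ).Sub ((H.refine j l).grid ℓ) := by
      simp only [HierData.refine]
      split_ifs
      · exact Grid.sub_insertLine _ l
      · exact ⟨Subset.rfl, Subset.rfl⟩
    -- The domains are unchanged, so the pieces over the refined grid inherit the support condition
    -- of level ℓ from `τ`.
    refine (Submodule.span_le.2 ?_) (Grid.mem_cone_of_sub hm hn hsub hτ.1)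
    rintro σ ⟨h1, h2⟩
    exact mem_nonnegCombinations_of_tsupport hm hn hH' hs' hℓ h1
      (subset_eq_empty (inter_subset_inter_left _ h2) hτ.2.1)
  have hweighted : ∀ t ⊆ hfin.toFinset,
      (fun q => ∑ τ ∈ t, w τ * τ q) ∈ nonnegCombinations hfin'.toFinset (H.dom 0) := by
    intro t ht
    convert Submodule.sum_mem (nonnegCombinations hfin'.toFinset (H.dom 0)) (t := t)
      (f := fun τ => (w τ).toNNReal • τ)
      (fun τ hτ => Submodule.smul_mem _ _ (hcomb τ (ht hτ))) using 1
    ext q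
    rw [Finset.sum_apply]
    refine Finset.sum_congr rfl fun τ hτ => ?_
    have := hw τ (hfin.mem_toFinset.1 (ht hτ))
    simp [NNReal.smul_def, this.le]
  obtain ⟨w', hw', hsum'⟩ := exists_positive_weights (s := hfin'.toFinset) (Ω := H.dom 0)
    (mem_nonnegCombinations_congr (hweighted _ subset_rfl) fun q hq => (hone q hq).symm) (by
      classical
      intro τ hτ
      obtain ⟨ℓ, hℓ, hτ⟩ := (hs' τ).1 hτ
      obtain ⟨σ, hσ, α, hα, g, hg, hσg⟩ := exists_parent_refine hm hn hH j l hℓ hτ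
      have hσK : σ ∈ H.hierBSplines m n := ⟨ℓ, hℓ, hσ⟩
      have hσs : σ ∈ hfin.toFinset := hfin.mem_toFinset.2 hσK
      have hgC : g ∈ nonnegCombinations hfin'.toFinset (H.dom 0) := by
        refine (Submodule.span_le.2 ?_) hg
        rintro ρ ⟨h1, h2⟩
        exact mem_nonnegCombinations_of_tsupport hm hn hH' hs' hℓ h1
          (subset_eq_empty (inter_subset_inter_left _ h2) hσ.2.1)
      -- In the old partition of unity only the summand of the parent is split: 1 = w_σ α τ + (w_σ g
      -- + the remaining summands).
      refine ⟨w σ * α, mul_pos (hw σ hσK) hα, _, Submodule.add_mem _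
        (Submodule.smul_mem _ (w σ).toNNReal hgC)
        (hweighted (hfin.toFinset.erase σ) (Finset.erase_subset _ _)), fun q hq => ?_⟩
      rw [← hone q hq, ← Finset.add_sum_erase _ _ hσs]
      have hσq : σ q = α * τ q + g q := by
        conv_lhs => rw [hσg]
        simp [NNReal.smul_def]
      simp only [Pi.add_apply, Pi.smul_apply, NNReal.smul_def, smul_eq_mul,
        Real.coe_toNNReal _ (hw σ hσK).le, hσq]
      ring)
  refine ⟨w', fun τ hτ => hw' τ ((hs' τ).2 hτ), fun q hq => ?_⟩
  rw [finsum_mem_eq_finite_toFinset_sum _ hfin']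
  exact hsum' q hq

end

theorem IsTMesh.isExtendable (hH : H.IsTMesh) (hN : 1 ≤ N)
    (hbd : frontier (H.dom 0) ∩ frontier (H.dom 1) = ∅)
    (hfine : ∀ ℓ, 1 ≤ ℓ → ℓ < N → (H.grid ℓ).ClassATilde m n (H.dom ℓ)) :
    H.IsExtendable m n where
  grid_nested := hH.grid_nested
  dom_last := hH.dom_last
  isBounded_dom_zero := by
    obtain ⟨S, hS, h⟩ := hH.dom_cells 0 hN
    rw [h]
    exact (Grid.isCompact_region hS).isBounded
  dom_zero_subset := by
    obtain ⟨S, -, h⟩ := hH.dom_cells 0 hN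
    rw [h]
    exact Grid.region_subset_closure_interior S
  isClosed_dom ℓ hℓ := by
    obtain ⟨S, hS, h⟩ := hH.dom_cells ℓ hℓ
    rw [h]
    exact Grid.isClosed_region hS
  dom_subset_interior ℓ h1 h2 := by
    have h01 : H.dom 1 ⊆ H.dom 0 := hH.dom_nested 0 hN
    have hℓ : H.dom ℓ ⊆ H.dom 1 := by
      induction ℓ, h1 using Nat.le_induction with
      | base => exact Subset.rfl
      | succ k hk ih => exact (hH.dom_nested k (by omega)).trans (ih (by omega))
    refine hℓ.trans fun q hq => ?_
    -- A point of Ω^1 on the boundary of Ω^0 is not interior to the smaller Ω^1 either, hence would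
    -- lie on both boundaries.
    by_contra hcon
    have h3 : q ∈ frontier (H.dom 0) ∩ frontier (H.dom 1) :=
      ⟨⟨subset_closure (h01 hq), hcon⟩, subset_closure hq, fun h => hcon (interior_mono h01 h)⟩
    rw [hbd] at h3
    exact h3
  exists_grid ℓ h1 h2 := by
    obtain ⟨S, hS, hext⟩ := (hfine ℓ h1 h2).exists_extendable
    exact ⟨H.grid ℓ, S, ⟨Subset.rfl, Subset.rfl⟩, hS, hext⟩

theorem HasWeightedPartition.refineList (hm : 1 ≤ m) (hn : 1 ≤ n) (hH : H.IsExtendable m n)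
    (h : H.HasWeightedPartition m n) (L : List (ℕ × AxisLine)) :
    (H.refineList L).HasWeightedPartition m n := by
  induction L generalizing H with
  | nil => exact h
  | cons p L ih => exact ih (hH.refine p.1 p.2) (HasWeightedPartition.refine hm hn hH h p.1 p.2)

end HierData

/-- If the hierarchical B-splines of a hierarchical mesh with suitable domains admit a positive
weighted partition of unity, then so do those of every mesh obtained by inserting lines. -/
theorem mainTheorem7 (m n N : ℕ) (hm : 1 ≤ m) (hn : 1 ≤ n) (hN : 1 ≤ N)
    (H : HierData N) (hH : H.IsTMesh)
    (h0 : (H.grid 0).ClassA (m - 1) (n - 1) (H.dom 0))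
    (hcoarse : ∀ ℓ, ℓ + 1 < N → (H.grid ℓ).ClassATilde (m - 1) (n - 1) (H.dom (ℓ + 1)))
    (hbd : frontier (H.dom 0) ∩ frontier (H.dom 1) = ∅)
    (hfine : ∀ ℓ, 1 ≤ ℓ → ℓ < N → (H.grid ℓ).ClassATilde m n (H.dom ℓ))
    (hunity : H.HasWeightedPartition m n)
    (L : List (ℕ × AxisLine)) (hL : H.NewLines L) :
    (H.refineList L).HasWeightedPartition m n :=
  hunity.refineList hm hn (hH.isExtendable hN hbd hfine) L
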